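/- Let $\mathbb K$ be a field of characteristic $0$, let $A$ be an infinite linearly ordered alphabet, and let $V=\mathbb K A$ be the vector space with basis $A$. For $n\ge 1$ let $\Gamma^nV\subseteq V^{\otimes n}$ be the span of the cyclic tensors $\sum_{k=0}^{n-1}(v_1\otimes\cdots\otimes v_n)\gamma^k$, where $(v_1\otimes\cdots\otimes v_n)\gamma^k$ is $v_1\otimes\cdots\otimes v_n$ rotated $k$ times to the left. Put $\overline\Gamma V=\bigoplus_{n\ge1}\Gamma^nV$, and let $H(V)=S(\overline\Gamma V)$ be its symmetric algebra, graded by giving $\Gamma^nV$ degree $n$, with the bialgebra structure in which the elements of $\overline\Gamma V$ are primitive. For a nonempty circular word $(w)$ over $A$, write also $(w)\in\Gamma^nV$ for the cyclic tensor of the word $w$. Fix a total order on the nonempty circular words over $A$ and, for each circular word, a word representing it (for example, the minimal representatives and their lexicographic order). For a commutative product of circular words $\underline m=(w_1)\cdots(w_p)$, written with $(w_1)\le\cdots\le(w_p)$ and each $w_i$ the chosen representative, let $n=|w_1|+\cdots+|w_p|$ and define the circular standardization $\operatorname{cstd}(\underline m)\in\mathfrak S_n$ as follows: standardize the word $w_1\cdots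 w_p$ (equal letters being ranked from left to right), parenthesize the result like $(w_1)\cdots(w_p)$, and read the factors as the cycles of a permutation. For $\sigma\in\mathfrak S_n$ let $H_\sigma(V)\subseteq H(V)$ be the span of the $\underline m$ with $\operatorname{cstd}(\underline m)=\sigma$. Let $R$ be the algebra of formal power series over $\mathbb K$ in commuting indeterminates $x_{ij}$ ($i,j\ge1$), and let $J\subseteq R$ be the ideal of the possibly infinite combinations of monomials divisible by some $x_{ij}x_{ik}$ (where $j=k$ is allowed). For $\sigma\in\mathfrak S_n$ let $M_\sigma\in R/J$ be the class of $\sum_{i_1<\cdots<i_n}x_{i_1i_{\sigma(1)}}\cdots x_{i_ni_{\sigma(n)}}$, and let $\mathbf{SGQSym}\subseteq R/J$ be the subalgebra generated by the $M_\sigma$, for $\sigma\in\mathfrak S_n$ and $n\ge0$. **Theorem.** The $M_\sigma$ span $\mathbf{SGQSym}$ as a vector space. Moreover $$H(V)=\bigoplus_{n\ge0}\bigoplus_{\sigma\in\mathfrak S_n}H_\sigma(V),$$ and if $\pi_\sigma$ denotes the projector of $H(V)$ onto $H_\sigma(V)$ associated with this decomposition, then the $\pi_\sigma$ span a (unital)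 subalgebra of the algebra $\operatorname{End}^{\mathrm{gr}}H(V)$ of degree-preserving linear endomorphisms of $H(V)$ under the convolution product $f*g=\mathrm{mult}\circ(f\otimes g)\circ\Delta$, and there is an isomorphism of algebras from this subalgebra onto $\mathbf{SGQSym}$ that sends $\pi_\sigma$ to $M_\sigma$ for every $\sigma$. -/

import Mathlib

open scoped TensorProduct

/-! ### Cyclic tensors and the Hopf algebra `H(V) = S(Γ̄ V)` -/

section CyclicTensors

variable (𝕂 : Type*) [Field 𝕂]

/-- The cyclic tensor `∑_{k=0}^{n-1} (v₁ ⊗ ⋯ ⊗ vₙ) γ^k`, where `γ = (1,2,…,n)` and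
`(v₁ ⊗ ⋯ ⊗ vₙ) γ^k` is the tensor of the word `v₁ ⋯ vₙ` rotated `k` times to the left.
Here `V^{⊗n}` is the homogeneous component of degree `n` of the tensor algebra of `V`. -/
noncomputable def cyclicTensor {V : Type*} [AddCommGroup V] [Module 𝕂 V] (l : List V) : TensorAlgebra 𝕂 V :=
  ∑ k ∈ Finset.range l.length, ((l.rotate k).map (TensorAlgebra.ι 𝕂)).prod

variable (V : Type*) [AddCommGroup V] [Module 𝕂 V]

/-- `Γⁿ V`, the subspace of `V^{⊗n}` spanned by the cyclic tensors. -/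
def Gamma (n : ℕ) : Submodule 𝕂 (TensorAlgebra 𝕂 V) :=
  Submodule.span 𝕂 {t | ∃ l : List V, l.length = n ∧ cyclicTensor 𝕂 l = t}

/-- `Γ̄ V = ⨁_{n ≥ 1} Γⁿ V`: the sum of the subspaces `Γⁿ V ⊆ V^{⊗n}` of the tensor algebra,
which is direct because these lie in different degrees. -/
def GammaBar : Submodule 𝕂 (TensorAlgebra 𝕂 V) :=
  ⨆ n : ℕ+, Gamma 𝕂 V n

/-- `H(V) = S(Γ̄ V)`. Mathlib's bialgebra structure on a symmetric algebra is the one in which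
the generators, here the elements of `Γ̄ V`, are primitive. -/
abbrev HAlg : Type _ := SymmetricAlgebra 𝕂 (GammaBar 𝕂 V)

variable {V}

/-- The cyclic tensor of a nonempty list of vectors, as an element of `Γ̄ V`. -/
noncomputable def cyclicTensorBar (l : {l : List V // l ≠ []}) : GammaBar 𝕂 V :=
  ⟨cyclicTensor 𝕂 l.1,
    Submodule.mem_iSup_of_mem (⟨l.1.length, List.length_pos_iff.2 l.2⟩ : ℕ+)
      (Submodule.subset_span ⟨l.1, rfl, rfl⟩)⟩

/-- The product in `H(V)` of a multiset of cyclic tensors. -/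
noncomputable def cyclicProduct (s : Multiset {l : List V // l ≠ []}) : HAlg 𝕂 V :=
  (s.map fun l => SymmetricAlgebra.ι 𝕂 (GammaBar 𝕂 V) (cyclicTensorBar 𝕂 l)).prod

variable (V)

/-- `Hₙ(V)`, the homogeneous component of degree `n` of `H(V)` (elements of `Γᵏ V` having
degree `k`). -/
def HGrade (n : ℕ) : Submodule 𝕂 (HAlg 𝕂 V) :=
  Submodule.span 𝕂 {h | ∃ s : Multiset {l : List V // l ≠ []},
    (s.map fun l => l.1.length).sum = n ∧ cyclicProduct 𝕂 s = h}

/-- The span in `H(V) ⊗ H(V)` of the tensors `x ⊗ y` with `x ∈ Hᵢ(V)`, `y ∈ Hⱼ(V)`,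
`i + j = n`. -/
def HGrade₂ (n : ℕ) : Submodule 𝕂 (HAlg 𝕂 V ⊗[𝕂] HAlg 𝕂 V) :=
  Submodule.span 𝕂 {t | ∃ i j, i + j = n ∧ ∃ x ∈ HGrade 𝕂 V i, ∃ y ∈ HGrade 𝕂 V j,
    x ⊗ₜ[𝕂] y = t}

variable {V}

theorem cyclicProduct_cons (l : {l : List V // l ≠ []}) (s : Multiset {l : List V // l ≠ []}) :
    cyclicProduct 𝕂 (l ::ₘ s) =
      SymmetricAlgebra.ι 𝕂 (GammaBar 𝕂 V) (cyclicTensorBar 𝕂 l) * cyclicProduct 𝕂 s := by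
  simp [cyclicProduct]

theorem cyclicProduct_mem (s : Multiset {l : List V // l ≠ []}) :
    cyclicProduct 𝕂 s ∈ HGrade 𝕂 V (s.map fun l => l.1.length).sum :=
  Submodule.subset_span ⟨s, rfl, rfl⟩

theorem HGrade_mul {i j : ℕ} {x y : HAlg 𝕂 V} (hx : x ∈ HGrade 𝕂 V i) (hy : y ∈ HGrade 𝕂 V j) :
    x * y ∈ HGrade 𝕂 V (i + j) := by
  have h := Submodule.mul_mem_mul hx hy
  rw [HGrade, HGrade, Submodule.span_mul_span] at h
  refine Submodule.span_mono ?_ h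
  rintro _ ⟨_, ⟨s, rfl, rfl⟩, _, ⟨t, rfl, rfl⟩, rfl⟩
  exact ⟨s + t, by simp, by simp [cyclicProduct]⟩

theorem ι_mem_HGrade (l : {l : List V // l ≠ []}) :
    SymmetricAlgebra.ι 𝕂 (GammaBar 𝕂 V) (cyclicTensorBar 𝕂 l) ∈ HGrade 𝕂 V l.1.length :=
  Submodule.subset_span ⟨{l}, by simp, by simp [cyclicProduct]⟩

theorem comul_cyclicProduct_mem (s : Multiset {l : List V // l ≠ []}) :
    Coalgebra.comul (R := 𝕂) (cyclicProduct 𝕂 s) ∈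
      HGrade₂ 𝕂 V (s.map fun l => l.1.length).sum := by
  induction s using Multiset.induction_on with
  | empty =>
    refine Submodule.subset_span ⟨0, 0, by simp, 1, ?_, 1, ?_, ?_⟩
    · simpa [cyclicProduct] using cyclicProduct_mem 𝕂 (0 : Multiset {l : List V // l ≠ []})
    · simpa [cyclicProduct] using cyclicProduct_mem 𝕂 (0 : Multiset {l : List V // l ≠ []})
    · simp [cyclicProduct, Algebra.TensorProduct.one_def]
  | cons l s ih =>
    rw [cyclicProduct_cons, Bialgebra.comul_mul, SymmetricAlgebra.comul_ι, Multiset.map_cons,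
      Multiset.sum_cons]
    generalize Coalgebra.comul (R := 𝕂) (cyclicProduct 𝕂 s) = t at ih
    induction ih using Submodule.span_induction with
    | mem t ht =>
      obtain ⟨i, j, hij, x, hx, y, hy, rfl⟩ := ht
      rw [add_mul, Algebra.TensorProduct.tmul_mul_tmul, Algebra.TensorProduct.tmul_mul_tmul,
        one_mul, one_mul]
      refine Submodule.add_mem _ (Submodule.subset_span ?_) (Submodule.subset_span ?_)
      · exact ⟨l.1.length + i, j, by omega, _, HGrade_mul 𝕂 (ι_mem_HGrade 𝕂 l) hx, y, hy, rfl⟩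
      · exact ⟨i, l.1.length + j, by omega, x, hx, _, HGrade_mul 𝕂 (ι_mem_HGrade 𝕂 l) hy, rfl⟩
    | zero => simp
    | add a b _ _ ha hb => rw [mul_add]; exact Submodule.add_mem _ ha hb
    | smul c a _ ha => rw [mul_smul_comm]; exact Submodule.smul_mem _ c ha

variable (V)

/-- `End^gr H(V)`: the degree preserving linear endomorphisms of `H(V)`, as a subalgebra of the
convolution algebra of all linear endomorphisms, whose product is
`f * g = mul ∘ (f ⊗ g) ∘ comul` and whose unit is `unit ∘ counit`. -/
def gradedEnd : Subalgebra 𝕂 (WithConv (HAlg 𝕂 V →ₗ[𝕂] HAlg 𝕂 V)) where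
  carrier := {f | ∀ n, ∀ x ∈ HGrade 𝕂 V n, f.ofConv x ∈ HGrade 𝕂 V n}
  add_mem' {f g} hf hg n x hx := Submodule.add_mem _ (hf n x hx) (hg n x hx)
  mul_mem' {f g} hf hg n x hx := by
    have key : ∀ t ∈ HGrade₂ 𝕂 V n,
        LinearMap.mul' 𝕂 (HAlg 𝕂 V) (TensorProduct.map f.ofConv g.ofConv t) ∈ HGrade 𝕂 V n := by
      intro t ht
      induction ht using Submodule.span_induction with
      | mem t ht =>
        obtain ⟨i, j, rfl, x, hx, y, hy, rfl⟩ := ht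
        simpa using HGrade_mul 𝕂 (hf i x hx) (hg j y hy)
      | zero => simp
      | add a b _ _ ha hb => rw [map_add, map_add]; exact Submodule.add_mem _ ha hb
      | smul c a _ ha => rw [map_smul, map_smul]; exact Submodule.smul_mem _ c ha
    refine key (Coalgebra.comul x) ?_
    induction hx using Submodule.span_induction with
    | mem x hx =>
      obtain ⟨s, rfl, rfl⟩ := hx
      exact comul_cyclicProduct_mem 𝕂 s
    | zero => simp
    | add a b _ _ ha hb => rw [map_add]; exact Submodule.add_mem _ ha hb
    | smul c a _ ha => rw [map_smul]; exact Submodule.smul_mem _ c ha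
  algebraMap_mem' r n x hx := by
    change r • algebraMap 𝕂 (HAlg 𝕂 V) (Coalgebra.counit x) ∈ _
    refine Submodule.smul_mem _ r ?_
    induction hx using Submodule.span_induction with
    | mem x hx =>
      obtain ⟨s, rfl, rfl⟩ := hx
      induction s using Multiset.induction_on with
      | empty => simpa [cyclicProduct] using
          cyclicProduct_mem 𝕂 (0 : Multiset {l : List V // l ≠ []})
      | cons l s _ => simp [cyclicProduct_cons]
    | zero => simp
    | add a b _ _ ha hb => rw [map_add, map_add]; exact Submodule.add_mem _ ha hb
    | smul c a _ ha =>
      rw [map_smul, smul_eq_mul, map_mul, ← Algebra.smul_def]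
      exact Submodule.smul_mem _ c ha

end CyclicTensors

/-! ### Circular words and circular standardization -/

section Standardization

/-- Circular words over `A` of length at least one. -/
def CircularWord (A : Type*) : Type _ := {c : Cycle A // c ≠ Cycle.nil}

variable {A : Type*} [LinearOrder A]

/-- The ordinary standardization of a word `w` of length `n`, as a word on `Fin n`: the `i`-th
letter is the rank of the letter `w i`, equal letters being ranked from left to right. -/
def wordStd (w : List A) : List (Fin w.length) :=
  List.ofFn fun i : Fin w.length =>
    ⟨(Finset.univ.filter fun j : Fin w.length =>
        w.get j < w.get i ∨ (w.get j = w.get i ∧ j < i)).card, by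
      have h := Finset.card_lt_univ_of_notMem (x := i)
        (s := Finset.univ.filter fun j : Fin w.length =>
          w.get j < w.get i ∨ (w.get j = w.get i ∧ j < i)) (by simp)
      simpa using h⟩

/-- Given words `w₁, …, w_p`, standardize the word `w = w₁ ⋯ w_p`, parenthesize the result like
`(w₁) ⋯ (w_p)`, and interpret the factors as the cycles of a permutation. -/
def stdCycles (L : List (List A)) : Σ n : ℕ, Equiv.Perm (Fin n) :=
  ⟨L.flatten.length,
    (((L.map List.length).splitLengths (wordStd L.flatten)).map List.formPerm).prod⟩

/-- The circular standardization of a commutative product of circular words: the factors are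
written in nondecreasing order, each circular word `c` being written as the word `rep c`. -/
def cstd [LinearOrder (CircularWord A)] (rep : CircularWord A → List A)
    (m : Multiset (CircularWord A)) : Σ n : ℕ, Equiv.Perm (Fin n) :=
  stdCycles ((m.sort (· ≤ ·)).map rep)

end Standardization

/-! ### The components `H_σ(V)` and the projectors `π_σ` -/

section Projectors

variable (𝕂 : Type*) [Field 𝕂] {A : Type*}

theorem cyclicTensor_rotate {V : Type*} [AddCommGroup V] [Module 𝕂 V] (l : List V) (n : ℕ) :
    cyclicTensor 𝕂 (l.rotate n) = cyclicTensor 𝕂 l := by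
  induction n with
  | zero => simp
  | succ n ih =>
    rw [← ih, ← List.rotate_rotate]
    generalize l.rotate n = l
    simp only [cyclicTensor, List.length_rotate, List.rotate_rotate]
    have h := Finset.sum_range_succ' (fun k => ((l.rotate k).map (TensorAlgebra.ι 𝕂)).prod) l.length
    rw [Finset.sum_range_succ] at h
    simp only [List.rotate_length, List.rotate_zero] at h
    simpa [add_comm] using (add_right_cancel h).symm

/-- The element `(w) ∈ Γ̄ V` defined by a circular word, for the vector space `V = 𝕂A` with
basis `A`. -/
noncomputable def circularElt (c : CircularWord A) : GammaBar 𝕂 (A →₀ 𝕂) :=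
  ⟨Quotient.lift (s := List.IsRotated.setoid A)
      (fun l : List A => cyclicTensor 𝕂 (l.map fun a => Finsupp.single a (1 : 𝕂)))
      (by
        rintro l _ ⟨n, rfl⟩
        simp only [List.map_rotate, cyclicTensor_rotate]) c.1, by
    obtain ⟨c, hc⟩ := c
    induction c using Quotient.inductionOn with
    | h l =>
      have hl : l ≠ [] := fun h => hc (by subst h; rfl)
      exact (cyclicTensorBar 𝕂 ⟨l.map fun a => Finsupp.single a (1 : 𝕂), by simpa using hl⟩).2⟩

/-- The basis element `(w₁) ⋯ (w_p)` of `H(V)` defined by a multiset of circular words. -/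
noncomputable def circularMonomial (m : Multiset (CircularWord A)) : HAlg 𝕂 (A →₀ 𝕂) :=
  (m.map fun c => SymmetricAlgebra.ι 𝕂 (GammaBar 𝕂 (A →₀ 𝕂)) (circularElt 𝕂 c)).prod

variable [LinearOrder A] [LinearOrder (CircularWord A)]

/-- `H_σ(V)`, the span of the products of circular words with circular standardization `σ`. -/
noncomputable def HComponent (rep : CircularWord A → List A) (σ : Σ n : ℕ, Equiv.Perm (Fin n)) :
    Submodule 𝕂 (HAlg 𝕂 (A →₀ 𝕂)) :=
  Submodule.span 𝕂 {h | ∃ m, cstd rep m = σ ∧ circularMonomial 𝕂 m = h}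

variable {𝕂}

/-- The projector `π_σ` onto `H_σ(V)` associated with the direct sum decomposition of `H(V)` into
the subspaces `H_τ(V)`, as an element of the convolution algebra. -/
noncomputable def circularProj {rep : CircularWord A → List A}
    (h : DirectSum.IsInternal (HComponent 𝕂 rep)) (σ : Σ n : ℕ, Equiv.Perm (Fin n)) :
    WithConv (HAlg 𝕂 (A →₀ 𝕂) →ₗ[𝕂] HAlg 𝕂 (A →₀ 𝕂)) :=
  WithConv.toConv <|
    (HComponent 𝕂 rep σ).subtype ∘ₗ
      DirectSum.component 𝕂 _ (fun τ => HComponent 𝕂 rep τ) σ ∘ₗ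
        (LinearEquiv.ofBijective (DirectSum.coeLinearMap (HComponent 𝕂 rep)) h).symm.toLinearMap

end Projectors

/-! ### The algebra `SGQSym` -/

section SGQSym

variable (𝕂 : Type*) [Field 𝕂]

/-- The ideal `J` of relations `x_{ij} x_{ik} = 0` (for all `i, j, k`, including `j = k`).
Since infinite sums of monomials are considered, it is an ideal of formal power series: it
consists of the (possibly infinite) combinations of monomials divisible by some
`x_{ij} x_{ik}`. -/
def relIdeal : Ideal (MvPowerSeries (ℕ × ℕ) 𝕂) where
  carrier := {f | ∀ m : (ℕ × ℕ) →₀ ℕ, MvPowerSeries.coeff m f ≠ 0 →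
    ∃ i j k, Finsupp.single (i, j) 1 + Finsupp.single (i, k) 1 ≤ m}
  zero_mem' m hm := absurd (map_zero _) hm
  add_mem' {f g} hf hg m hm := by
    by_cases h : MvPowerSeries.coeff m f = 0
    · exact hg m fun h' => hm (by rw [map_add, h, h', add_zero])
    · exact hf m h
  smul_mem' f g hg m hm := by
    classical
    rw [smul_eq_mul, MvPowerSeries.coeff_mul] at hm
    obtain ⟨p, hp, hne⟩ := Finset.exists_ne_zero_of_sum_ne_zero hm
    obtain ⟨i, j, k, h⟩ := hg p.2 (right_ne_zero_of_mul hne)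
    refine ⟨i, j, k, h.trans ?_⟩
    rw [← Finset.HasAntidiagonal.mem_antidiagonal.1 hp]
    exact le_add_self

/-- The formal series `∑_{i₁ < ⋯ < iₙ} x_{i₁ i_{f(1)}} ⋯ x_{iₙ i_{f(n)}}` of an endofunction `f`:
the coefficient of a monomial is the number of terms of the sum equal to it. -/
noncomputable def endoSeries {n : ℕ} (f : Fin n → Fin n) : MvPowerSeries (ℕ × ℕ) 𝕂 :=
  fun m => (Nat.card {i : Fin n ↪o ℕ // ∑ k, Finsupp.single (i k, i (f k)) 1 = m} : 𝕂)

/-- `M_σ`, as an element of the quotient by the relations. -/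
noncomputable def MPerm (σ : Σ n : ℕ, Equiv.Perm (Fin n)) :
    MvPowerSeries (ℕ × ℕ) 𝕂 ⧸ relIdeal 𝕂 :=
  Ideal.Quotient.mk (relIdeal 𝕂) (endoSeries 𝕂 σ.2)

/-- `SGQSym`, the subalgebra generated by the `M_σ`. -/
noncomputable def SGQSym : Subalgebra 𝕂 (MvPowerSeries (ℕ × ℕ) 𝕂 ⧸ relIdeal 𝕂) :=
  Algebra.adjoin 𝕂 (Set.range (MPerm 𝕂))

end SGQSym

/-!
The proof compares two families, the projectors `π_σ` and the series `M_σ`, and shows that each is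
linearly independent, contains the unit (for `σ` the permutation of the empty set), and multiplies
with the same structure constants. The constant at `ρ` in the product of the elements of indices `σ`
and `τ` is the number of ways to split `{1, …, n}` into two `ρ`-invariant subsets on which `ρ`
standardizes to `σ` and to `τ`. Such a splitting is encoded in `Split` as a pair of increasing maps
that intertwine `σ` and `τ` with `ρ` and have complementary ranges.

*The projectors.* In characteristic zero the circular words form a basis of `Γ̄ V`: they span by
multilinearity, and a word occurs with nonzero coefficient in exactly one of them. Hence their
commutative products form a basis of `H(V)`, and grouping the products by circular standardization
decomposes `H(V)`. As the factors of a product `m` are primitive, `π_σ * π_τ` multiplies `m` by the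
number of ways to distribute its factors over two subproducts with standardizations `σ` and `τ`.
Now `cstd m` is the standardization of the permutation that moves each position in the words of `m`
to the next one in the same word, where positions are sorted by their letters and then from left to
right (`realizes_cstd`). Subproducts correspond to invariant sets of positions, with the induced
order and permutation, so the number depends only on `cstd m` and counts the splittings of `cstd m`
(`card_subset_cstd_eq`, `circularProj_mul`). The projectors are linearly independent because every
permutation is a circular standardization: write its cycles in distinct letters
(`cstd_surjective`).

*The series.* A monomial of `M_σ` is a permutation of a finite set of integers whose standardization
is `σ`. In a product `M_σ M_τ`, pairs of overlapping sets give monomials in the ideal of relations,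
and a pair of disjoint sets is a permutation of their union together with a splitting of it
(`card_endoMonomial_add_eq`, `MPerm_mul`).
-/

/-! ### The basis of circular words -/

section CircularBasis

variable (𝕂 : Type*) [Field 𝕂] {A : Type*}

theorem coe_circularElt (l : List A) (hl : l ≠ []) :
    (circularElt 𝕂 ⟨(l : Cycle A), by simpa using hl⟩ : TensorAlgebra 𝕂 (A →₀ 𝕂)) =
      cyclicTensor 𝕂 (l.map fun a => Finsupp.single a (1 : 𝕂)) := rfl

/-- The algebra homomorphism `T(𝕂A) → 𝕂⟨A⟩` that reads a tensor of letters as a word. -/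
noncomputable def tensorToWords : TensorAlgebra 𝕂 (A →₀ 𝕂) →ₐ[𝕂] MonoidAlgebra 𝕂 (FreeMonoid A) :=
  TensorAlgebra.lift 𝕂 <| Finsupp.linearCombination 𝕂 fun a =>
    MonoidAlgebra.of 𝕂 (FreeMonoid A) (FreeMonoid.of a)

theorem tensorToWords_word (l : List A) :
    tensorToWords 𝕂 ((l.map fun a => Finsupp.single a (1 : 𝕂)).map
      (TensorAlgebra.ι 𝕂)).prod = MonoidAlgebra.of 𝕂 (FreeMonoid A) (FreeMonoid.ofList l) := by
  induction l with
  | nil => simp [MonoidAlgebra.one_def]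
  | cons a l ih =>
    rw [FreeMonoid.ofList_cons, List.map_cons, List.map_cons, List.prod_cons, map_mul, map_mul, ih]
    simp [tensorToWords]

open Classical in
/-- The coefficient of the word `u` in the cyclic tensor of `l` counts the rotations of `l` equal
to `u`. -/
theorem tensorToWords_cyclicTensor (l u : List A) :
    (tensorToWords 𝕂 (cyclicTensor 𝕂 (l.map fun a => Finsupp.single a (1 : 𝕂)))).coeff
      (FreeMonoid.ofList u) = ((Finset.range l.length).filter fun k => l.rotate k = u).card := by
  rw [cyclicTensor, map_sum, Finset.card_filter, List.length_map]
  push_cast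
  rw [MonoidAlgebra.coeff_sum, Finsupp.finsetSum_apply]
  refine Finset.sum_congr rfl fun k _ => ?_
  rw [← List.map_rotate, tensorToWords_word, MonoidAlgebra.of_apply, MonoidAlgebra.coeff_single,
    Finsupp.single_apply]
  simp

theorem linearIndependent_circularElt [CharZero 𝕂] :
    LinearIndependent 𝕂 (circularElt 𝕂 : CircularWord A → _) := by
  classical
  have hrep : ∀ c : CircularWord A, ∃ l : List A, l ≠ [] ∧ (l : Cycle A) = c.1 := by
    rintro ⟨c, hc⟩
    induction c using Quotient.inductionOn with
    | h l => exact ⟨l, fun h => hc (by subst h; rfl), rfl⟩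
  choose u hu hu' using hrep
  have hcoe : ∀ c, (circularElt 𝕂 c : TensorAlgebra 𝕂 (A →₀ 𝕂)) =
      cyclicTensor 𝕂 ((u c).map fun a => Finsupp.single a (1 : 𝕂)) := fun c => by
    rw [← coe_circularElt 𝕂 (u c) (hu c)]
    congr; exact Subtype.ext (hu' c).symm
  -- the functional "coefficient of the word `u c`"
  let φ : CircularWord A → Module.Dual 𝕂 (GammaBar 𝕂 (A →₀ 𝕂)) := fun c =>
    Finsupp.lapply (FreeMonoid.ofList (u c)) ∘ₗ
      (MonoidAlgebra.coeffLinearEquiv 𝕂).toLinearMap ∘ₗ (tensorToWords 𝕂).toLinearMap ∘ₗ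
        (GammaBar 𝕂 (A →₀ 𝕂)).subtype
  have hφ : ∀ c d, φ c (circularElt 𝕂 d) =
      ((Finset.range (u d).length).filter fun k => (u d).rotate k = u c).card := fun c d => by
    rw [← tensorToWords_cyclicTensor, ← hcoe]; rfl
  -- the trivial rotation makes the count positive, hence nonzero in characteristic zero
  have hne : ∀ c, φ c (circularElt 𝕂 c) ≠ 0 := fun c => by
    rw [hφ, Nat.cast_ne_zero, Finset.card_ne_zero]
    exact ⟨0, by simpa [List.length_pos_iff] using hu c⟩
  refine LinearIndependent.of_pairwise_dual_eq_zero_one _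
    (fun c => (φ c (circularElt 𝕂 c))⁻¹ • φ c) ?_ fun c => by simp [hne c]
  intro c d hcd
  have : φ c (circularElt 𝕂 d) = 0 := by
    rw [hφ, Nat.cast_eq_zero, Finset.card_eq_zero, Finset.filter_eq_empty_iff]
    intro k _ hk
    refine hcd (Subtype.ext ?_)
    rw [← hu' c, ← hu' d, ← hk]
    exact Cycle.coe_eq_coe.2 (List.IsRotated.symm ⟨k, rfl⟩)
  simp [this]

/-- Expanding multilinearly, a cyclic tensor of `n` vectors is a combination of circular words of
length `n`. -/
theorem cyclicTensor_mem_span {n : ℕ} (hn : n ≠ 0) (l : List (A →₀ 𝕂)) (hl : l.length = n) :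
    cyclicTensor 𝕂 l ∈ Submodule.span 𝕂 {t | ∃ c : CircularWord A, c.1.length = n ∧
      (circularElt 𝕂 c : TensorAlgebra 𝕂 (A →₀ 𝕂)) = t} := by
  set N := Submodule.span 𝕂 {t | ∃ c : CircularWord A, c.1.length = n ∧
      (circularElt 𝕂 c : TensorAlgebra 𝕂 (A →₀ 𝕂)) = t} with hN
  have : NeZero n := ⟨hn⟩
  let T : MultilinearMap 𝕂 (fun _ : Fin n => A →₀ 𝕂) (TensorAlgebra 𝕂 (A →₀ 𝕂)) :=
    ∑ k ∈ Finset.range n, (TensorAlgebra.tprod 𝕂 (A →₀ 𝕂) n).domDomCongr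
      (Equiv.addRight (Fin.ofNat n k))
  have hT : ∀ v, T v = cyclicTensor 𝕂 (List.ofFn v) := fun v => by
    simp only [T, cyclicTensor, List.length_ofFn, sum_apply]
    refine Finset.sum_congr rfl fun k _ => ?_
    rw [MultilinearMap.domDomCongr_apply, TensorAlgebra.tprod_apply]
    congr 1
    refine List.ext_getElem (by simp) fun i h1 h2 => ?_
    simp only [List.getElem_ofFn, List.getElem_map, List.getElem_rotate, List.length_ofFn,
      Equiv.coe_addRight]
    congr 2
    exact Fin.ext (by simp [Fin.val_add])
  -- modulo the span, this multilinear map vanishes on families of letters, hence everywhere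
  have h0 : N.mkQ.compMultilinearMap T = 0 := by
    refine Module.Basis.ext_multilinear (fun _ => Finsupp.basisSingleOne) fun a => ?_
    simp only [LinearMap.compMultilinearMap_apply, zero_apply, Submodule.mkQ_apply,
      Submodule.Quotient.mk_eq_zero, hT, Finsupp.coe_basisSingleOne]
    refine Submodule.subset_span ⟨⟨(List.ofFn a : Cycle A), by simp [hn]⟩, by simp, ?_⟩
    rw [coe_circularElt 𝕂 _ (by simp [hn]), List.map_ofFn]
    rfl
  have := congrArg (fun f => f fun i : Fin n => l[i]) h0
  simp only [LinearMap.compMultilinearMap_apply, zero_apply, Submodule.mkQ_apply,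
      Submodule.Quotient.mk_eq_zero, hT] at this
  subst hl
  simpa using this

theorem cyclicTensorBar_mem_span (l : {l : List (A →₀ 𝕂) // l ≠ []}) :
    cyclicTensorBar 𝕂 l ∈ Submodule.span 𝕂 {t | ∃ c : CircularWord A, c.1.length = l.1.length ∧
      circularElt 𝕂 c = t} := by
  have h := cyclicTensor_mem_span 𝕂 (by simpa using l.2) l.1 rfl
  rw [← Submodule.apply_mem_span_image_iff_mem_span
    (f := (GammaBar 𝕂 (A →₀ 𝕂)).subtype) (Submodule.subtype_injective _)]
  refine Submodule.span_mono ?_ h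
  rintro _ ⟨c, hc, rfl⟩
  exact ⟨circularElt 𝕂 c, ⟨c, hc, rfl⟩, rfl⟩

theorem span_circularElt :
    ⊤ ≤ Submodule.span 𝕂 (Set.range (circularElt 𝕂 : CircularWord A → _)) := by
  rw [← Submodule.map_le_map_iff_of_injective (f := (GammaBar 𝕂 (A →₀ 𝕂)).subtype)
    (Submodule.subtype_injective _), Submodule.map_subtype_top, Submodule.map_span]
  change ⨆ n : ℕ+, Gamma 𝕂 (A →₀ 𝕂) n ≤ _
  refine iSup_le fun n => Submodule.span_le.2 ?_
  rintro _ ⟨l, hl, rfl⟩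
  refine Submodule.span_mono ?_ (cyclicTensor_mem_span 𝕂 n.ne_zero l hl)
  rintro _ ⟨c, -, rfl⟩
  exact ⟨_, ⟨c, rfl⟩, rfl⟩

end CircularBasis

/-! ### The decomposition of `H(V)` and the convolution of the projectors -/

theorem Module.Basis.isInternal_span_fiber {ι κ 𝕂 M : Type*} [DecidableEq κ] [Ring 𝕂]
    [AddCommGroup M] [Module 𝕂 M] (b : Module.Basis ι 𝕂 M) (g : ι → κ) :
    DirectSum.IsInternal fun k => Submodule.span 𝕂 {x | ∃ i, g i = k ∧ b i = x} := by
  rw [DirectSum.isInternal_submodule_iff_iSupIndep_and_iSup_eq_top]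
  constructor
  · intro k
    simp_rw [← Submodule.span_iUnion]
    refine (b.linearIndependent.disjoint_span_image (s := g ⁻¹' {k}) (t := g ⁻¹' {k}ᶜ)
      (disjoint_compl_right.preimage g)).mono (Submodule.span_mono ?_) (Submodule.span_mono ?_)
    · rintro _ ⟨i, hi, rfl⟩
      exact ⟨i, hi, rfl⟩
    · refine Set.iUnion₂_subset fun l hl => ?_
      rintro _ ⟨i, hi, rfl⟩
      exact ⟨i, by simpa [hi] using hl, rfl⟩
  · rw [eq_top_iff, ← b.span_eq, Submodule.span_le]
    rintro _ ⟨i, rfl⟩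
    exact Submodule.mem_iSup_of_mem (g i) (Submodule.subset_span ⟨i, rfl, rfl⟩)

section Decomposition

variable (𝕂 : Type*) [Field 𝕂] {A : Type*}

/-- The basis of `H(V)` consisting of the products of circular words. -/
noncomputable def circularBasis [CharZero 𝕂] :
    Module.Basis (Multiset (CircularWord A)) 𝕂 (HAlg 𝕂 (A →₀ 𝕂)) := by
  classical
  exact (Module.Basis.symmetricAlgebra (Module.Basis.mk (linearIndependent_circularElt 𝕂)
    (span_circularElt 𝕂 (A := A)))).reindex Multiset.toFinsupp.toEquiv.symm

theorem circularBasis_apply [CharZero 𝕂] (m : Multiset (CircularWord A)) :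
    circularBasis 𝕂 m = circularMonomial 𝕂 m := by
  classical
  set b := Module.Basis.mk (linearIndependent_circularElt 𝕂) (span_circularElt 𝕂 (A := A)) with hb
  have h : circularBasis 𝕂 m = (SymmetricAlgebra.equivMvPolynomial b).symm
      (MvPolynomial.monomial (Multiset.toFinsupp m) 1) := by
    simp [circularBasis, Module.Basis.symmetricAlgebra, ← hb]
  rw [h]
  induction m using Multiset.induction_on with
  | empty => simp [circularMonomial]
  | cons c m ih =>
    have hc := ih (by simp [circularBasis, Module.Basis.symmetricAlgebra, ← hb])
    rw [← Multiset.singleton_add, map_add, ← one_mul (1 : 𝕂), ← MvPolynomial.monomial_mul,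
      map_mul, hc, Multiset.toFinsupp_singleton]
    change (SymmetricAlgebra.equivMvPolynomial b).symm (MvPolynomial.X c) * _ = _
    rw [SymmetricAlgebra.equivMvPolynomial_symm_X]
    simp [circularMonomial, hb]

theorem circularElt_eq_cyclicTensorBar (c : CircularWord A) :
    ∃ l : {l : List (A →₀ 𝕂) // l ≠ []}, l.1.length = c.1.length ∧
      cyclicTensorBar 𝕂 l = circularElt 𝕂 c := by
  obtain ⟨c, hc⟩ := c
  induction c using Quotient.inductionOn with
  | h l =>
    have hl : l ≠ [] := fun h => hc (by subst h; rfl)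
    exact ⟨⟨l.map fun a => Finsupp.single a (1 : 𝕂), by simpa using hl⟩, by
      simp only [List.length_map]; rfl, rfl⟩

theorem circularMonomial_mem_HGrade (m : Multiset (CircularWord A)) :
    circularMonomial 𝕂 m ∈ HGrade 𝕂 (A →₀ 𝕂) (m.map fun c => c.1.length).sum := by
  induction m using Multiset.induction_on with
  | empty =>
    exact Submodule.subset_span ⟨0, by simp, by simp [cyclicProduct, circularMonomial]⟩
  | cons c m ih =>
    obtain ⟨l, hl, hlc⟩ := circularElt_eq_cyclicTensorBar 𝕂 c
    have h := HGrade_mul 𝕂 (ι_mem_HGrade 𝕂 l) ih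
    rw [hl, hlc] at h
    simpa [circularMonomial] using h

theorem HGrade_le_span_circularMonomial (n : ℕ) :
    HGrade 𝕂 (A →₀ 𝕂) n ≤ Submodule.span 𝕂
      {h | ∃ m : Multiset (CircularWord A), (m.map fun c => c.1.length).sum = n ∧
        circularMonomial 𝕂 m = h} := by
  refine Submodule.span_le.2 ?_
  rintro _ ⟨s, rfl, rfl⟩
  induction s using Multiset.induction_on with
  | empty =>
    exact Submodule.subset_span ⟨0, by simp, by simp [cyclicProduct, circularMonomial]⟩
  | cons l s ih =>
    rw [cyclicProduct_cons]
    have h := Submodule.mul_mem_mul (Submodule.mem_map_of_mem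
      (f := SymmetricAlgebra.ι 𝕂 (GammaBar 𝕂 (A →₀ 𝕂))) (cyclicTensorBar_mem_span 𝕂 l)) ih
    rw [Submodule.map_span, Submodule.span_mul_span] at h
    refine Submodule.span_mono ?_ h
    rintro _ ⟨_, ⟨_, ⟨c, hc, rfl⟩, rfl⟩, _, ⟨m, hm, rfl⟩, rfl⟩
    exact ⟨c ::ₘ m, by simp [hc, hm], by simp [circularMonomial]⟩

/-- The factors of a product of circular words are primitive, so its coproduct distributes them
over the two tensor factors in all possible ways. -/
theorem comul_circularMonomial {p : ℕ} (w : Fin p → CircularWord A) :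
    Coalgebra.comul (R := 𝕂) (circularMonomial 𝕂 (Finset.univ.val.map w)) =
      ∑ I : Finset (Fin p), circularMonomial 𝕂 (I.val.map w) ⊗ₜ[𝕂]
        circularMonomial 𝕂 (Iᶜ.val.map w) := by
  have hprod : ∀ I : Finset (Fin p), circularMonomial 𝕂 (I.val.map w) =
      ∏ b ∈ I, SymmetricAlgebra.ι 𝕂 (GammaBar 𝕂 (A →₀ 𝕂)) (circularElt 𝕂 (w b)) := fun I => by
    rw [circularMonomial, Multiset.map_map]; rfl
  simp only [hprod]
  rw [← Bialgebra.comulAlgHom_apply, map_prod]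
  simp only [Bialgebra.comulAlgHom_apply, SymmetricAlgebra.comul_ι]
  rw [Finset.prod_add, Finset.powerset_univ]
  refine Finset.sum_congr rfl fun I _ => ?_
  rw [← Finset.compl_eq_univ_sdiff]
  have hl := map_prod (Algebra.TensorProduct.includeLeft (R := 𝕂) (S := 𝕂)
    (A := HAlg 𝕂 (A →₀ 𝕂)) (B := HAlg 𝕂 (A →₀ 𝕂)))
    (fun b => SymmetricAlgebra.ι 𝕂 (GammaBar 𝕂 (A →₀ 𝕂)) (circularElt 𝕂 (w b))) I
  have hr := map_prod (Algebra.TensorProduct.includeRight (R := 𝕂)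
    (A := HAlg 𝕂 (A →₀ 𝕂)) (B := HAlg 𝕂 (A →₀ 𝕂)))
    (fun b => SymmetricAlgebra.ι 𝕂 (GammaBar 𝕂 (A →₀ 𝕂)) (circularElt 𝕂 (w b))) Iᶜ
  simp only [Algebra.TensorProduct.includeLeft_apply,
    Algebra.TensorProduct.includeRight_apply] at hl hr
  rw [← hl, ← hr, Algebra.TensorProduct.tmul_mul_tmul, one_mul, mul_one]

theorem counit_circularMonomial [DecidableEq (Multiset (CircularWord A))]
    (m : Multiset (CircularWord A)) :
    Coalgebra.counit (R := 𝕂) (circularMonomial 𝕂 m) = if m = 0 then 1 else 0 := by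
  induction m using Multiset.induction_on with
  | empty => simp [circularMonomial]
  | cons c m _ => simp [circularMonomial]

/-- Elements of the convolution algebra are determined by their values on products of circular
words. -/
theorem conv_ext [CharZero 𝕂] {f g : WithConv (HAlg 𝕂 (A →₀ 𝕂) →ₗ[𝕂] HAlg 𝕂 (A →₀ 𝕂))}
    (h : ∀ m, f.ofConv (circularMonomial 𝕂 m) = g.ofConv (circularMonomial 𝕂 m)) : f = g := by
  refine WithConv.ext ((circularBasis 𝕂).ext fun m => ?_)
  rw [circularBasis_apply, h]

variable [LinearOrder A] [LinearOrder (CircularWord A)] (rep : CircularWord A → List A)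

theorem isInternal_HComponent [CharZero 𝕂] : DirectSum.IsInternal (HComponent 𝕂 rep) := by
  have h := (circularBasis 𝕂 (A := A)).isInternal_span_fiber (cstd rep)
  simp only [circularBasis_apply] at h
  exact h

variable {𝕂 rep}

theorem circularProj_circularMonomial (hdec : DirectSum.IsInternal (HComponent 𝕂 rep))
    (σ : Σ n : ℕ, Equiv.Perm (Fin n)) (m : Multiset (CircularWord A)) :
    (circularProj hdec σ).ofConv (circularMonomial 𝕂 m) =
      if cstd rep m = σ then circularMonomial 𝕂 m else 0 := by
  have hm : circularMonomial 𝕂 m ∈ HComponent 𝕂 rep (cstd rep m) :=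
    Submodule.subset_span ⟨m, rfl, rfl⟩
  have key : (LinearEquiv.ofBijective (DirectSum.coeLinearMap (HComponent 𝕂 rep)) hdec).symm
      (circularMonomial 𝕂 m) =
        DirectSum.lof 𝕂 _ (fun τ => HComponent 𝕂 rep τ) (cstd rep m) ⟨_, hm⟩ := by
    have h := DirectSum.coeLinearMap_lof (HComponent 𝕂 rep) (cstd rep m) ⟨_, hm⟩
    exact (LinearEquiv.symm_apply_eq _).2 h.symm
  simp only [circularProj, LinearMap.comp_apply, LinearEquiv.coe_coe, key,
    WithConv.ofConv_toConv]
  split_ifs with h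
  · subst h
    rw [DirectSum.component.lof_self]; rfl
  · rw [DirectSum.component.of, dif_neg h, map_zero]

theorem circularProj_mul_circularMonomial (hdec : DirectSum.IsInternal (HComponent 𝕂 rep))
    (σ τ : Σ n : ℕ, Equiv.Perm (Fin n)) {p : ℕ} (w : Fin p → CircularWord A) :
    (circularProj hdec σ * circularProj hdec τ).ofConv
        (circularMonomial 𝕂 (Finset.univ.val.map w)) =
      (Nat.card {I : Finset (Fin p) // cstd rep (I.val.map w) = σ ∧ cstd rep (Iᶜ.val.map w) = τ} :
        𝕂) • circularMonomial 𝕂 (Finset.univ.val.map w) := by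
  rw [LinearMap.convMul_apply, comul_circularMonomial, map_sum, map_sum]
  simp only [TensorProduct.map_tmul, LinearMap.mul'_apply, circularProj_circularMonomial,
    ite_zero_mul_ite_zero]
  have hmul : ∀ I : Finset (Fin p), circularMonomial 𝕂 (I.val.map w) *
      circularMonomial 𝕂 (Iᶜ.val.map w) = circularMonomial 𝕂 (Finset.univ.val.map w) := by
    intro I
    rw [circularMonomial, circularMonomial, circularMonomial, ← Multiset.prod_add,
      ← Multiset.map_add, ← Multiset.map_add, ← Finset.disjUnion_val _ _ disjoint_compl_right,
      Finset.disjUnion_eq_union, Finset.union_compl]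
  simp only [hmul]
  rw [← Finset.sum_filter, Finset.sum_const, Nat.card_eq_fintype_card, Fintype.card_subtype,
    Nat.cast_smul_eq_nsmul]

theorem circularProj_mem_gradedEnd (hdec : DirectSum.IsInternal (HComponent 𝕂 rep))
    (σ : Σ n : ℕ, Equiv.Perm (Fin n)) : circularProj hdec σ ∈ gradedEnd 𝕂 (A →₀ 𝕂) := by
  intro n x hx
  have hle : Submodule.span 𝕂 {h | ∃ m : Multiset (CircularWord A),
      (m.map fun c => c.1.length).sum = n ∧ circularMonomial 𝕂 m = h} ≤
        (HGrade 𝕂 (A →₀ 𝕂) n).comap (circularProj hdec σ).ofConv := by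
    refine Submodule.span_le.2 ?_
    rintro _ ⟨m, rfl, rfl⟩
    rw [SetLike.mem_coe, Submodule.mem_comap, circularProj_circularMonomial]
    split_ifs
    · exact circularMonomial_mem_HGrade 𝕂 m
    · exact Submodule.zero_mem _
  exact hle (HGrade_le_span_circularMonomial 𝕂 n hx)

theorem linearIndependent_circularProj [CharZero 𝕂]
    (hdec : DirectSum.IsInternal (HComponent 𝕂 rep)) (hsurj : Function.Surjective (cstd rep)) :
    LinearIndependent 𝕂 (circularProj hdec) := by
  choose m hm using hsurj
  refine LinearIndependent.of_pairwise_dual_eq_zero_one _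
    (fun σ => (circularBasis 𝕂).coord (m σ) ∘ₗ LinearMap.applyₗ (circularMonomial 𝕂 (m σ)) ∘ₗ
      (WithConv.linearEquiv 𝕂 _).toLinearMap) ?_ ?_
  · intro σ τ hστ
    change (circularBasis 𝕂).coord (m σ) ((circularProj hdec τ).ofConv _) = 0
    rw [circularProj_circularMonomial, if_neg (by rwa [hm]), map_zero]
  · intro σ
    change (circularBasis 𝕂).coord (m σ) ((circularProj hdec σ).ofConv _) = 1
    rw [circularProj_circularMonomial, if_pos (hm σ), ← circularBasis_apply]
    simp

end Decomposition

/-! ### Splittings of a permutation into two invariant parts -/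

section Splitting

variable {Q : Type*} [LinearOrder Q]

/-- The self-map `f` of the linearly ordered set `Q` restricts to the finite subset `T`, and the
standardization of the restriction is `σ`: `T` is enumerated increasingly by some `i`, which
intertwines `σ` and `f`. -/
def Realizes (f : Q → Q) (T : Set Q) (σ : Σ n : ℕ, Equiv.Perm (Fin n)) : Prop :=
  ∃ i : Fin σ.1 ↪o Q, Set.range i = T ∧ ∀ y, f (i y) = i (σ.2 y)

/-- The ways to split `Q` into two subsets on which `f` standardizes to `σ` and to `τ`. -/
def Split (f : Q → Q) (σ τ : Σ n : ℕ, Equiv.Perm (Fin n)) : Type _ :=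
  {ij : (Fin σ.1 ↪o Q) × (Fin τ.1 ↪o Q) // IsCompl (Set.range ij.1) (Set.range ij.2) ∧
    (∀ y, f (ij.1 y) = ij.1 (σ.2 y)) ∧ ∀ y, f (ij.2 y) = ij.2 (τ.2 y)}

theorem OrderEmbedding.eq_of_range_eq {n : ℕ} {i j : Fin n ↪o Q}
    (h : Set.range i = Set.range j) : i = j :=
  DFunLike.coe_injective ((StrictMono.range_inj i.strictMono j.strictMono).1 h)

theorem OrderEmbedding.fin_card_eq {n k : ℕ} {i : Fin n ↪o Q} {j : Fin k ↪o Q}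
    (h : Set.range i = Set.range j) : n = k := by
  have := congrArg Set.ncard h
  simpa [← Set.image_univ, Set.ncard_image_of_injective _ i.injective,
    Set.ncard_image_of_injective _ j.injective, Set.ncard_univ] using this

theorem Realizes.unique {f : Q → Q} {T : Set Q} {σ τ : Σ n : ℕ, Equiv.Perm (Fin n)}
    (hσ : Realizes f T σ) (hτ : Realizes f T τ) : σ = τ := by
  obtain ⟨n, σ⟩ := σ
  obtain ⟨k, τ⟩ := τ
  obtain ⟨i, hi, hσ⟩ := hσ
  obtain ⟨j, hj, hτ⟩ := hτ
  obtain rfl : n = k := OrderEmbedding.fin_card_eq (hi.trans hj.symm)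
  obtain rfl := OrderEmbedding.eq_of_range_eq (hi.trans hj.symm)
  congr 1
  exact Equiv.ext fun y => i.injective ((hσ y).symm.trans (hτ y))

theorem range_trans_orderEmbedding {n k : ℕ} (i : Fin n ↪o Fin k) (K : Fin k ↪o Q) :
    Set.range (i.trans K) = K '' Set.range i := by
  rw [← Set.range_comp]; rfl

/-- The number of splittings is invariant under an isomorphism of linearly ordered sets with
self-maps. -/
theorem Realizes.card_split_eq {f : Q → Q} {ρ : Σ n : ℕ, Equiv.Perm (Fin n)}
    (h : Realizes f Set.univ ρ) (σ τ : Σ n : ℕ, Equiv.Perm (Fin n)) :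
    Nat.card (Split f σ τ) = Nat.card (Split ρ.2 σ τ) := by
  obtain ⟨K, hK, hf⟩ := h
  let e : Fin ρ.1 ≃o Q := StrictMono.orderIsoOfSurjective K K.strictMono (Set.range_eq_univ.1 hK)
  have he : ∀ y, f (e y) = e (ρ.2 y) := hf
  have he' : ∀ x, ρ.2 (e.symm x) = e.symm (f x) := fun x => by
    rw [← e.apply_eq_iff_eq, ← he, e.apply_symm_apply, e.apply_symm_apply]
  refine Nat.card_congr ⟨fun s => ⟨(s.1.1.trans e.symm.toOrderEmbedding,
    s.1.2.trans e.symm.toOrderEmbedding), ?_, fun y => ?_, fun y => ?_⟩,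
    fun s => ⟨(s.1.1.trans e.toOrderEmbedding, s.1.2.trans e.toOrderEmbedding), ?_,
      fun y => ?_, fun y => ?_⟩, fun s => ?_, fun s => ?_⟩
  · have : IsCompl (e.symm '' Set.range s.1.1) (e.symm '' Set.range s.1.2) :=
      e.symm.toEquiv.toOrderIsoSet.isCompl s.2.1
    rwa [← Set.range_comp, ← Set.range_comp] at this
  · exact (he' _).trans (congrArg e.symm (s.2.2.1 y))
  · exact (he' _).trans (congrArg e.symm (s.2.2.2 y))
  · have : IsCompl (e '' Set.range s.1.1) (e '' Set.range s.1.2) :=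
      e.toEquiv.toOrderIsoSet.isCompl s.2.1
    rwa [← Set.range_comp, ← Set.range_comp] at this
  · exact (he _).trans (congrArg e (s.2.2.1 y))
  · exact (he _).trans (congrArg e (s.2.2.2 y))
  · refine Subtype.ext (Prod.ext ?_ ?_) <;> ext y <;> exact e.apply_symm_apply _
  · refine Subtype.ext (Prod.ext ?_ ?_) <;> ext y <;> simp

theorem Split.bijective_sumElim {f : Q → Q} {σ τ : Σ n : ℕ, Equiv.Perm (Fin n)}
    (s : Split f σ τ) : Function.Bijective (Sum.elim s.1.1 s.1.2) := by
  constructor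
  · exact s.1.1.injective.sumElim s.1.2.injective fun a b h =>
      Set.disjoint_left.1 s.2.1.disjoint ⟨a, rfl⟩ ⟨b, h.symm⟩
  · rw [← Set.range_eq_univ, Set.Sum.elim_range]
    exact s.2.1.sup_eq_top

theorem Split.card_eq {n : ℕ} {f : Fin n → Fin n} {σ τ : Σ n : ℕ, Equiv.Perm (Fin n)}
    (s : Split f σ τ) : n = σ.1 + τ.1 := by
  simpa using (Nat.card_eq_of_bijective _ s.bijective_sumElim).symm

instance {f : Q → Q} [Finite Q] {σ τ : Σ n : ℕ, Equiv.Perm (Fin n)} : Finite (Split f σ τ) :=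
  Finite.of_injective (fun s => ((s.1.1 : Fin σ.1 → Q), (s.1.2 : Fin τ.1 → Q))) fun s t h => by
    rw [Prod.mk.injEq] at h
    exact Subtype.ext (Prod.ext (DFunLike.coe_injective h.1) (DFunLike.coe_injective h.2))

end Splitting

/-! ### The multiplication of `SGQSym` -/

section Monomials

/-- The monomial `x_{i₁ i_{f(1)}} ⋯ x_{iₙ i_{f(n)}}`. -/
noncomputable def endoMonomial {n : ℕ} (f : Fin n → Fin n) (i : Fin n ↪o ℕ) : (ℕ × ℕ) →₀ ℕ :=
  ∑ k, Finsupp.single (i k, i (f k)) 1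

variable {n k l : ℕ} (f : Fin n → Fin n) (i : Fin n ↪o ℕ)

theorem mapDomain_fst_endoMonomial :
    Finsupp.mapDomain Prod.fst (endoMonomial f i) = ∑ k, Finsupp.single (i k) 1 := by
  simp [endoMonomial, Finsupp.mapDomain_finsetSum]

theorem mapDomain_fst_endoMonomial_le_one (a : ℕ) :
    Finsupp.mapDomain Prod.fst (endoMonomial f i) a ≤ 1 := by
  rw [mapDomain_fst_endoMonomial, Finsupp.finsetSum_apply]
  simp only [Finsupp.single_apply, Finset.sum_boole, Nat.cast_id]
  exact Finset.card_le_one.2 fun x hx y hy => i.injective <| by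
    rw [(Finset.mem_filter.1 hx).2, (Finset.mem_filter.1 hy).2]

theorem mem_range_iff_mapDomain_fst_endoMonomial (a : ℕ) :
    a ∈ Set.range i ↔ Finsupp.mapDomain Prod.fst (endoMonomial f i) a ≠ 0 := by
  rw [mapDomain_fst_endoMonomial, Finsupp.finsetSum_apply]
  simp [Finsupp.single_apply]

/-- The monomials of the series `M_σ` are not killed by the relations. -/
theorem not_exists_le_endoMonomial :
    ¬ ∃ a b c, Finsupp.single (a, b) 1 + Finsupp.single (a, c) 1 ≤ endoMonomial f i := by
  rintro ⟨a, b, c, h⟩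
  obtain ⟨r, hr⟩ := exists_add_of_le h
  have h1 := mapDomain_fst_endoMonomial_le_one f i a
  rw [hr, Finsupp.mapDomain_add, Finsupp.mapDomain_add] at h1
  simp only [Finsupp.mapDomain_single, Finsupp.coe_add, Pi.add_apply, Finsupp.single_eq_same] at h1
  omega

theorem single_le_endoMonomial (x : Fin n) :
    Finsupp.single (i x, i (f x)) 1 ≤ endoMonomial f i :=
  Finset.single_le_sum (f := fun k => Finsupp.single (i k, i (f k)) 1)
    (fun _ _ => zero_le) (Finset.mem_univ x)

theorem range_eq_of_endoMonomial_eq {f : Fin n → Fin n} {i : Fin n ↪o ℕ} {g : Fin k → Fin k}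
    {j : Fin k ↪o ℕ} (h : endoMonomial f i = endoMonomial g j) : Set.range i = Set.range j := by
  ext a
  rw [mem_range_iff_mapDomain_fst_endoMonomial f, mem_range_iff_mapDomain_fst_endoMonomial g, h]

theorem eq_of_endoMonomial_eq {g : Fin n → Fin n} (h : endoMonomial f i = endoMonomial g i) :
    f = g := by
  funext x
  have h1 : endoMonomial g i (i x, i (f x)) ≠ 0 := by
    rw [← h]
    have := single_le_endoMonomial f i x (i x, i (f x))
    rw [Finsupp.single_eq_same] at this
    omega
  rw [endoMonomial, Finsupp.finsetSum_apply] at h1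
  obtain ⟨y, -, hy⟩ := Finset.exists_ne_zero_of_sum_ne_zero h1
  rw [Finsupp.single_apply_ne_zero] at hy
  have hy := hy.1
  simp only [Prod.mk.injEq, EmbeddingLike.apply_eq_iff_eq] at hy
  rw [hy.2, hy.1]

instance (m : (ℕ × ℕ) →₀ ℕ) : Subsingleton {i : Fin n ↪o ℕ // endoMonomial f i = m} :=
  ⟨fun i j => Subtype.ext
    (OrderEmbedding.eq_of_range_eq (range_eq_of_endoMonomial_eq (i.2.trans j.2.symm)))⟩

theorem Split.endoMonomial_add {f : Fin n → Fin n} {σ τ : Σ n : ℕ, Equiv.Perm (Fin n)}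
    (s : Split f σ τ) (K : Fin n ↪o ℕ) :
    endoMonomial σ.2 (s.1.1.trans K) + endoMonomial τ.2 (s.1.2.trans K) = endoMonomial f K := by
  rw [endoMonomial, endoMonomial, endoMonomial,
    ← (Equiv.ofBijective _ s.bijective_sumElim).sum_comp, Fintype.sum_sum_type]
  simp [s.2.2.1, s.2.2.2]

theorem exists_le_endoMonomial_add {f : Fin k → Fin k} {g : Fin l → Fin l} {i : Fin k ↪o ℕ}
    {j : Fin l ↪o ℕ} (h : ¬ Disjoint (Set.range i) (Set.range j)) :
    ∃ a b c, Finsupp.single (a, b) 1 + Finsupp.single (a, c) 1 ≤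
      endoMonomial f i + endoMonomial g j := by
  obtain ⟨a, ⟨x, rfl⟩, y, hy⟩ := Set.not_disjoint_iff.1 h
  refine ⟨i x, i (f x), j (g y), add_le_add (single_le_endoMonomial f i x) ?_⟩
  rw [← hy]
  exact single_le_endoMonomial g j y

/-- A pair of permutations of disjoint finite sets of integers is the same as a permutation of the
union together with a splitting of it. -/
theorem exists_split {σ τ : Σ n : ℕ, Equiv.Perm (Fin n)} (i : Fin σ.1 ↪o ℕ) (j : Fin τ.1 ↪o ℕ)
    (h : Disjoint (Set.range i) (Set.range j)) :
    ∃ (ρ : Equiv.Perm (Fin (σ.1 + τ.1))) (s : Split ρ σ τ) (K : Fin (σ.1 + τ.1) ↪o ℕ),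
      s.1.1.trans K = i ∧ s.1.2.trans K = j := by
  let U : Finset ℕ := Finset.univ.map i.toEmbedding ∪ Finset.univ.map j.toEmbedding
  have hU : U.card = σ.1 + τ.1 := by
    rw [Finset.card_union_of_disjoint, Finset.card_map, Finset.card_map, Finset.card_fin,
      Finset.card_fin]
    rw [← Finset.disjoint_coe]
    simpa using h
  -- relabel the union increasingly by `Fin (σ.1 + τ.1)` and transport `σ ⊕ τ` to it
  let K := U.orderIsoOfFin hU
  have hi : ∀ x, i x ∈ U := fun x => by simp [U]
  have hj : ∀ x, j x ∈ U := fun x => by simp [U]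
  let i' : Fin σ.1 ↪o Fin (σ.1 + τ.1) := OrderEmbedding.ofStrictMono
    (fun x => K.symm ⟨i x, hi x⟩) fun x y hxy => by simpa using hxy
  let j' : Fin τ.1 ↪o Fin (σ.1 + τ.1) := OrderEmbedding.ofStrictMono
    (fun x => K.symm ⟨j x, hj x⟩) fun x y hxy => by simpa using hxy
  have hKi : ∀ x, (K (i' x) : ℕ) = i x := fun x =>
    congrArg Subtype.val (K.apply_symm_apply ⟨i x, hi x⟩)
  have hKj : ∀ x, (K (j' x) : ℕ) = j x := fun x =>
    congrArg Subtype.val (K.apply_symm_apply ⟨j x, hj x⟩)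
  have hd : Disjoint (Set.range i') (Set.range j') := by
    rw [Set.disjoint_left]
    rintro _ ⟨x, rfl⟩ ⟨y, hy⟩
    exact Set.disjoint_left.1 h ⟨x, rfl⟩ ⟨y, by rw [← hKj, hy, hKi]⟩
  have hb : Function.Bijective (Sum.elim i' j') := by
    rw [Fintype.bijective_iff_injective_and_card]
    refine ⟨i'.injective.sumElim j'.injective fun a b hab =>
      Set.disjoint_left.1 hd ⟨a, rfl⟩ ⟨b, hab.symm⟩, by simp⟩
  let g := Equiv.ofBijective _ hb
  let ρ : Equiv.Perm (Fin (σ.1 + τ.1)) := (g.symm.trans (Equiv.sumCongr σ.2 τ.2)).trans g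
  have hgi : ∀ x, g.symm (i' x) = Sum.inl x := fun x => by rw [g.symm_apply_eq]; rfl
  have hgj : ∀ x, g.symm (j' x) = Sum.inr x := fun x => by rw [g.symm_apply_eq]; rfl
  refine ⟨ρ, ⟨(i', j'), ⟨hd, ?_⟩, fun y => ?_, fun y => ?_⟩,
    OrderEmbedding.ofStrictMono (fun x => (K x : ℕ)) fun x y hxy => by simpa using hxy, ?_, ?_⟩
  · exact codisjoint_iff.2 ((Set.Sum.elim_range i' j').symm.trans hb.surjective.range_eq)
  · simp only [ρ, Equiv.trans_apply, hgi]; rfl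
  · simp only [ρ, Equiv.trans_apply, hgj]; rfl
  · ext x; exact hKi x
  · ext x; exact hKj x

theorem Split.range_eq {f : Fin n → Fin n} {σ τ : Σ n : ℕ, Equiv.Perm (Fin n)}
    (s : Split f σ τ) (K : Fin n ↪o ℕ) :
    Set.range K = Set.range (s.1.1.trans K) ∪ Set.range (s.1.2.trans K) := by
  rw [range_trans_orderEmbedding, range_trans_orderEmbedding, ← Set.image_union,
    ← Set.image_univ]
  exact congrArg _ s.2.1.sup_eq_top.symm

/-- Counting a monomial outside the relations in `M_σ M_τ` and in `∑ c_{στ}^ρ M_ρ`. -/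
theorem card_endoMonomial_add_eq (σ τ : Σ n : ℕ, Equiv.Perm (Fin n)) {m : (ℕ × ℕ) →₀ ℕ}
    (hm : ¬ ∃ a b c, Finsupp.single (a, b) 1 + Finsupp.single (a, c) 1 ≤ m) :
    Nat.card {ij : (Fin σ.1 ↪o ℕ) × (Fin τ.1 ↪o ℕ) //
        endoMonomial σ.2 ij.1 + endoMonomial τ.2 ij.2 = m} =
      ∑ ρ : Equiv.Perm (Fin (σ.1 + τ.1)), Nat.card (Split ρ σ τ) *
        Nat.card {K : Fin (σ.1 + τ.1) ↪o ℕ // endoMonomial ρ K = m} := by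
  simp_rw [← Nat.card_prod]
  rw [← Nat.card_sigma]
  symm
  refine Nat.card_eq_of_bijective (fun x => ⟨(x.2.1.1.1.trans x.2.2.1, x.2.1.1.2.trans x.2.2.1),
    (x.2.1.endoMonomial_add _).trans x.2.2.2⟩) ⟨?_, ?_⟩
  · rintro ⟨ρ, s, K, hK⟩ ⟨ρ', s', K', hK'⟩ h
    simp only [Subtype.mk.injEq, Prod.mk.injEq] at h
    obtain ⟨h1, h2⟩ := h
    obtain rfl : K = K' := OrderEmbedding.eq_of_range_eq <| by
      rw [s.range_eq, s'.range_eq, h1, h2]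
    have e1 : s.1.1 = s'.1.1 := by
      ext y; exact congrArg Fin.val (K.injective (DFunLike.congr_fun h1 y))
    have e2 : s.1.2 = s'.1.2 := by
      ext y; exact congrArg Fin.val (K.injective (DFunLike.congr_fun h2 y))
    obtain rfl : ρ = ρ' := by
      ext z
      obtain ⟨y | y, rfl⟩ := s.bijective_sumElim.surjective z
      · simp only [Sum.elim_inl, s.2.2.1]
        rw [e1, s'.2.2.1]
      · simp only [Sum.elim_inr, s.2.2.2]
        rw [e2, s'.2.2.2]
    obtain rfl : s = s' := Subtype.ext (Prod.ext e1 e2)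
    rfl
  · rintro ⟨⟨i, j⟩, rfl⟩
    obtain ⟨ρ, s, K, rfl, rfl⟩ := exists_split i j
      (by_contra fun h => hm (exists_le_endoMonomial_add h))
    exact ⟨⟨ρ, s, K, (s.endoMonomial_add K).symm⟩, rfl⟩

variable (𝕂 : Type*) [Field 𝕂]

theorem coeff_endoSeries (m : (ℕ × ℕ) →₀ ℕ) : MvPowerSeries.coeff m (endoSeries 𝕂 f) =
    (Nat.card {i : Fin n ↪o ℕ // endoMonomial f i = m} : 𝕂) := rfl

theorem coeff_endoSeries_mul (f : Fin k → Fin k) (g : Fin l → Fin l) (m : (ℕ × ℕ) →₀ ℕ) :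
    MvPowerSeries.coeff m (endoSeries 𝕂 f * endoSeries 𝕂 g) =
      (Nat.card {ij : (Fin k ↪o ℕ) × (Fin l ↪o ℕ) //
        endoMonomial f ij.1 + endoMonomial g ij.2 = m} : 𝕂) := by
  classical
  let e : {ij : (Fin k ↪o ℕ) × (Fin l ↪o ℕ) // endoMonomial f ij.1 + endoMonomial g ij.2 = m} ≃
      Σ p : {p // p ∈ Finset.HasAntidiagonal.antidiagonal m},
        {i : Fin k ↪o ℕ // endoMonomial f i = p.1.1} ×
          {j : Fin l ↪o ℕ // endoMonomial g j = p.1.2} :=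
    { toFun := fun ij => ⟨⟨(endoMonomial f ij.1.1, endoMonomial g ij.1.2),
        Finset.HasAntidiagonal.mem_antidiagonal.2 ij.2⟩,
        ⟨ij.1.1, rfl⟩, ⟨ij.1.2, rfl⟩⟩
      invFun := fun x => ⟨(x.2.1.1, x.2.2.1), by
        rw [x.2.1.2, x.2.2.2]; exact Finset.HasAntidiagonal.mem_antidiagonal.1 x.1.2⟩
      left_inv := fun _ => rfl
      right_inv := by
        rintro ⟨⟨⟨p, q⟩, h⟩, ⟨i, hi⟩, ⟨j, hj⟩⟩
        obtain rfl : endoMonomial f i = p := hi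
        obtain rfl : endoMonomial g j = q := hj
        rfl }
  rw [MvPowerSeries.coeff_mul, Nat.card_congr e, Nat.card_sigma, ← Finset.sum_coe_sort]
  simp [coeff_endoSeries, Nat.card_prod]

theorem MPerm_mul (σ τ : Σ n : ℕ, Equiv.Perm (Fin n)) :
    MPerm 𝕂 σ * MPerm 𝕂 τ = ∑ ρ : Equiv.Perm (Fin (σ.1 + τ.1)),
      (Nat.card (Split ρ σ τ) : 𝕂) • MPerm 𝕂 ⟨σ.1 + τ.1, ρ⟩ := by
  have h : ∑ ρ : Equiv.Perm (Fin (σ.1 + τ.1)),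
      (Nat.card (Split ρ σ τ) : 𝕂) • MPerm 𝕂 ⟨σ.1 + τ.1, ρ⟩ =
        Ideal.Quotient.mkₐ 𝕂 (relIdeal 𝕂) (∑ ρ : Equiv.Perm (Fin (σ.1 + τ.1)),
          (Nat.card (Split ρ σ τ) : 𝕂) • endoSeries 𝕂 ρ) := by
    simp only [map_sum, map_smul]; rfl
  rw [h, MPerm, MPerm, ← map_mul]
  refine Ideal.Quotient.eq.2 fun m hm => ?_
  by_contra hrel
  refine hm ?_
  rw [map_sub, sub_eq_zero, coeff_endoSeries_mul, card_endoMonomial_add_eq σ τ hrel, map_sum]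
  simp [coeff_endoSeries]

theorem MPerm_one : MPerm 𝕂 ⟨0, 1⟩ = 1 := by
  classical
  rw [MPerm, ← map_one (Ideal.Quotient.mk (relIdeal 𝕂))]
  congr 1
  ext m
  rw [coeff_endoSeries, MvPowerSeries.coeff_one]
  split_ifs with h
  · subst h
    have : Nonempty {i : Fin 0 ↪o ℕ // endoMonomial (1 : Equiv.Perm (Fin 0)) i = 0} :=
      ⟨⟨Fin.valOrderEmb 0, rfl⟩⟩
    rw [Nat.card_unique, Nat.cast_one]
  · have : IsEmpty {i : Fin 0 ↪o ℕ // endoMonomial (1 : Equiv.Perm (Fin 0)) i = m} :=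
      ⟨fun i => h i.2.symm⟩
    rw [Nat.card_of_isEmpty, Nat.cast_zero]

theorem linearIndependent_MPerm : LinearIndependent 𝕂 (MPerm 𝕂) := by
  classical
  -- the coefficient of the monomial of `σ` on the smallest possible indices separates the `M_σ`
  let μ : (Σ n : ℕ, Equiv.Perm (Fin n)) → (ℕ × ℕ) →₀ ℕ := fun σ =>
    endoMonomial σ.2 (Fin.valOrderEmb σ.1)
  have hμ : ∀ σ τ, MvPowerSeries.coeff (μ σ) (endoSeries 𝕂 τ.2) = if σ = τ then 1 else 0 := by
    intro σ τ
    rw [coeff_endoSeries]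
    split_ifs with h
    · subst h
      have : Nonempty {i : Fin σ.1 ↪o ℕ // endoMonomial σ.2 i = μ σ} := ⟨⟨_, rfl⟩⟩
      rw [Nat.card_unique, Nat.cast_one]
    · have : IsEmpty {i : Fin τ.1 ↪o ℕ // endoMonomial τ.2 i = μ σ} := ⟨by
        rintro ⟨i, hi⟩
        refine h ?_
        obtain ⟨n, σ⟩ := σ
        obtain ⟨k, τ⟩ := τ
        have hr := range_eq_of_endoMonomial_eq hi
        obtain rfl : k = n := OrderEmbedding.fin_card_eq hr
        obtain rfl := OrderEmbedding.eq_of_range_eq hr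
        obtain rfl : τ = σ := DFunLike.coe_injective (eq_of_endoMonomial_eq _ _ hi)
        rfl⟩
      rw [Nat.card_of_isEmpty, Nat.cast_zero]
  rw [linearIndependent_iff']
  intro s g hg σ hσ
  have h : ∑ τ ∈ s, g τ • MPerm 𝕂 τ =
      Ideal.Quotient.mkₐ 𝕂 (relIdeal 𝕂) (∑ τ ∈ s, g τ • endoSeries 𝕂 τ.2) := by
    simp only [map_sum, map_smul]; rfl
  rw [h] at hg
  have hg : (∑ τ ∈ s, g τ • endoSeries 𝕂 τ.2) ∈ relIdeal 𝕂 := Ideal.Quotient.eq_zero_iff_mem.1 hg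
  by_contra h0
  refine not_exists_le_endoMonomial _ _ (hg (μ σ) ?_)
  simp [hμ, hσ, h0]

end Monomials

/-! ### Circular standardization as the standardization of a permutation of positions -/

section Standardization

theorem List.formPerm_prod_apply_of_mem {α : Type*} [DecidableEq α] {M : List (List α)}
    (hM : M.flatten.Nodup) {l : List α} (hl : l ∈ M) {x : α} (hx : x ∈ l) :
    (M.map List.formPerm).prod x = l.formPerm x := by
  induction M with
  | nil => simp at hl
  | cons l' M ih =>
    rw [List.flatten_cons, List.nodup_append'] at hM
    obtain ⟨-, hM, hd⟩ := hM
    -- the cycles are disjoint, so all the others fix the entries of `l`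
    have hfix : ∀ (M : List (List α)) y, y ∉ M.flatten → (M.map List.formPerm).prod y = y := by
      intro M
      induction M with
      | nil => simp
      | cons l M ih =>
        intro y hy
        rw [List.flatten_cons, List.mem_append, not_or] at hy
        rw [List.map_cons, List.prod_cons, Equiv.Perm.mul_apply, ih y hy.2,
          List.formPerm_apply_of_notMem hy.1]
    rw [List.map_cons, List.prod_cons, Equiv.Perm.mul_apply]
    rcases List.mem_cons.1 hl with rfl | hl
    · rw [hfix M x (hd hx)]
    · rw [ih hM hl]
      exact List.formPerm_apply_of_notMem fun h => hd h
        (List.mem_flatten.2 ⟨l, hl, List.formPerm_apply_mem_of_mem hx⟩)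

theorem List.map_splitLengths {α β : Type*} (g : α → β) (sz : List ℕ) (l : List α) :
    (sz.splitLengths l).map (List.map g) = sz.splitLengths (l.map g) := by
  induction sz generalizing l with
  | nil => simp
  | cons n sz ih => simp [ih, List.map_take, List.map_drop]

theorem List.splitLengths_flatten {α : Type*} (X : List (List α)) :
    (X.map List.length).splitLengths X.flatten = X := by
  induction X with
  | nil => simp
  | cons l X ih => simp [ih]

variable {A : Type*} [LinearOrder A]

/-- The letters of a word `F.map a` are labelled by the elements of a linearly ordered set `P`. If
the order of `P` refines the order of the letters, and orders equal letters from left to right,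
then the standardization replaces each letter by the rank of its label. -/
theorem exists_map_wordStd {P : Type*} [LinearOrder P] (a : P → A) (F : List P) (w : List A)
    (hw : w = F.map a) (hF : F.Pairwise fun x y => x < y ↔ a x ≤ a y) :
    ∃ e : Fin w.length ↪o P, (wordStd w).map e = F := by
  subst hw
  have hne : F.Pairwise fun x y => x ≠ y ∧ (x < y ↔ a x ≤ a y) := hF.imp fun {x y} h =>
    ⟨fun hxy => by subst hxy; exact absurd (h.2 le_rfl) (lt_irrefl _), h⟩
  have hnd : F.Nodup := hne.imp And.left
  have hcard : F.toFinset.card = (F.map a).length := by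
    rw [List.toFinset_card_of_nodup hnd, List.length_map]
  let e := F.toFinset.orderEmbOfFin hcard
  have hmem : ∀ i : Fin (F.map a).length, F[i.1]'(by simpa using i.2) ∈ Set.range e := fun i => by
    rw [Finset.range_orderEmbOfFin]; simp
  -- `r i` is the rank of the `i`-th label
  choose r hr using hmem
  have hrb : Function.Bijective r := Finite.injective_iff_bijective.1 fun i j hij => by
    have := (hr i).symm.trans ((congrArg e hij).trans (hr j))
    exact Fin.ext ((hnd.getElem_inj_iff).1 this)
  have hlt : ∀ i j, (((F.map a).get j < (F.map a).get i ∨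
      ((F.map a).get j = (F.map a).get i ∧ j < i)) ↔ r j < r i) := by
    intro i j
    have hre : r j < r i ↔ F[j.1]'(by simpa using j.2) < F[i.1]'(by simpa using i.2) := by
      rw [← e.lt_iff_lt, hr, hr]
    rw [hre]
    simp only [List.get_eq_getElem, List.getElem_map]
    rcases lt_trichotomy j i with h | rfl | h
    · have := (List.pairwise_iff_getElem.1 hne j i (by simpa using j.2) (by simpa using i.2) h).2
      rw [this, le_iff_lt_or_eq]
      simp [h]
    · simp
    · have := List.pairwise_iff_getElem.1 hne i j (by simpa using i.2) (by simpa using j.2) h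
      rw [← not_le, ← this.2, ← not_le (a := F[i.1]'(by simpa using i.2)), le_iff_lt_or_eq,
        or_iff_left this.1]
      simp [h.le]
  refine ⟨e, List.ext_getElem (by simp [wordStd]) fun i h1 h2 => ?_⟩
  have hi : i < (F.map a).length := by simpa using h2
  rw [← hr ⟨i, hi⟩]
  simp only [wordStd, List.getElem_map, List.getElem_ofFn]
  congr 1
  refine Fin.ext ?_
  simp only [hlt]
  rw [← Fin.card_Iio (r ⟨i, hi⟩)]
  exact Finset.card_bij (fun j _ => r j) (by simp) (fun _ _ _ _ h => hrb.1 h) fun z hz => by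
    obtain ⟨j, rfl⟩ := hrb.2 z
    exact ⟨j, by simpa using hz, rfl⟩

/-- Write the positions of the words `w₁, …, w_p` as the lists `X` of labels. The permutation
`stdCycles` is the standardization of the permutation `f` of the positions that moves each position
to the next one of the same word, cyclically. -/
theorem realizes_stdCycles {P : Type*} [LinearOrder P] (a : P → A) (X : List (List P))
    (hX : X.flatten.Pairwise fun x y => x < y ↔ a x ≤ a y) (f : P → P)
    (hf : ∀ l ∈ X, ∀ (t : ℕ) (ht : t < l.length),
      f l[t] = l[(t + 1) % l.length]'(Nat.mod_lt _ (Nat.zero_lt_of_lt ht))) :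
    Realizes f {x | x ∈ X.flatten} (stdCycles (X.map (List.map a))) := by
  have hw : (X.map (List.map a)).flatten = X.flatten.map a := by rw [List.map_flatten]
  obtain ⟨e, he⟩ := exists_map_wordStd a X.flatten _ hw hX
  have hnd : X.flatten.Nodup := hX.imp fun {x y} h hxy => by
    subst hxy; exact absurd (h.2 le_rfl) (lt_irrefl _)
  -- `M` is the parenthesized standardized word; enumerating the labels by `e` turns it into `X`
  set M := ((X.map (List.map a)).map List.length).splitLengths
    (wordStd (X.map (List.map a)).flatten) with hMdef
  have hMX : M.map (List.map e) = X := by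
    rw [hMdef, List.map_splitLengths, he]
    have : (X.map (List.map a)).map List.length = X.map List.length := by simp
    rw [this, List.splitLengths_flatten]
  have hMf : M.flatten.map e = X.flatten := by rw [List.map_flatten, hMX]
  have hMnd : M.flatten.Nodup := List.Nodup.of_map e (hMf ▸ hnd)
  have hrange : Set.range e = {x | x ∈ X.flatten} := by
    have hall : ∀ y, y ∈ M.flatten := by
      have : M.flatten.toFinset = Finset.univ := by
        rw [← Finset.card_eq_iff_eq_univ, List.toFinset_card_of_nodup hMnd, Fintype.card_fin]
        rw [← List.length_map (f := e), hMf, hw, List.length_map]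
      intro y
      rw [← List.mem_toFinset, this]
      exact Finset.mem_univ y
    ext x
    rw [Set.mem_ofPred_eq, ← hMf, List.mem_map]
    exact ⟨fun ⟨y, hy⟩ => ⟨y, hall y, hy⟩, fun ⟨y, _, hy⟩ => ⟨y, hy⟩⟩
  suffices h : ∀ y, f (e y) = e ((M.map List.formPerm).prod y) from ⟨e, hrange, h⟩
  intro y
  have hy : e y ∈ X.flatten := hrange.le ⟨y, rfl⟩
  rw [← hMf, List.mem_map_of_injective e.injective, List.mem_flatten] at hy
  obtain ⟨l, hl, hy⟩ := hy
  obtain ⟨t, ht, rfl⟩ := List.getElem_of_mem hy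
  have hlnd : l.Nodup := (List.nodup_flatten.1 hMnd).1 l hl
  have h1 := hf (l.map e) ((congrArg (l.map e ∈ ·) hMX).mp (List.mem_map_of_mem hl)) t
    (by simpa using ht)
  simp only [List.getElem_map, List.length_map] at h1
  rw [h1, ← List.formPerm_apply_getElem l hlnd t ht]
  congr 1
  exact (List.formPerm_prod_apply_of_mem hMnd hl (List.getElem_mem ht)).symm

end Standardization

/-! ### Positions in a product of circular words -/

section Positions

variable {A : Type*}

/-- The positions of the letters in the words `W 0, …, W (p - 1)`. -/
@[ext]
structure Position {p : ℕ} (W : Fin p → List A) where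
  /-- the word containing the position -/
  block : Fin p
  /-- the position within this word -/
  idx : Fin (W block).length

namespace Position

variable {p : ℕ} {W : Fin p → List A}

/-- The letter in a given position. -/
def letter (x : Position W) : A := (W x.block)[x.idx]

/-- The next position in the same word, cyclically. -/
def next (x : Position W) : Position W :=
  ⟨x.block, ⟨(x.idx + 1) % (W x.block).length, Nat.mod_lt _ (Nat.zero_lt_of_lt x.idx.2)⟩⟩

/-- The sorting key of a position: positions are ordered by their letters, positions with equal
letters from left to right. -/
def key (x : Position W) : A ×ₗ (ℕ ×ₗ ℕ) := toLex (x.letter, toLex (x.block.1, x.idx.1))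

theorem key_injective : Function.Injective (key : Position W → _) := by
  rintro ⟨b, t⟩ ⟨b', t'⟩ h
  simp only [key, EmbeddingLike.apply_eq_iff_eq, Prod.mk.injEq] at h
  obtain ⟨-, h1, h2⟩ := h
  obtain rfl := Fin.ext h1
  obtain rfl := Fin.ext h2
  rfl

/-- The positions in the word `W b`, from left to right. -/
def inBlock (W : Fin p → List A) (b : Fin p) : List (Position W) :=
  (List.finRange (W b).length).map fun t => ⟨b, t⟩

theorem map_letter_inBlock (b : Fin p) : (inBlock W b).map letter = W b := by
  rw [inBlock, List.map_map]
  exact List.ext_getElem (by simp) fun i h1 h2 => by simp [letter]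

theorem mem_inBlock {b : Fin p} {x : Position W} : x ∈ inBlock W b ↔ x.block = b := by
  obtain ⟨c, t⟩ := x
  simp only [inBlock, List.mem_map, List.mem_finRange, true_and]
  constructor
  · rintro ⟨t', h⟩
    exact (congrArg block h).symm
  · rintro rfl
    exact ⟨t, rfl⟩

theorem iterate_next (x : Position W) (d : ℕ) :
    next^[d] x = ⟨x.block, ⟨(x.idx + d) % (W x.block).length,
      Nat.mod_lt _ (Nat.zero_lt_of_lt x.idx.2)⟩⟩ := by
  induction d with
  | zero =>
    obtain ⟨b, t⟩ := x
    simp [Nat.mod_eq_of_lt t.2]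
  | succ d ih =>
    rw [Function.iterate_succ_apply', ih]
    simp [next, add_assoc]

theorem exists_iterate_next {x y : Position W} (h : x.block = y.block) :
    ∃ d, next^[d] x = y := by
  obtain ⟨b, t⟩ := x
  obtain ⟨c, s⟩ := y
  obtain rfl : b = c := h
  refine ⟨s + ((W b).length - t), ?_⟩
  rw [iterate_next]
  have : t.1 + (s + ((W b).length - t)) = s + (W b).length := by omega
  simp [this, Nat.mod_eq_of_lt s.2]

variable [LinearOrder A]

noncomputable instance : LinearOrder (Position W) := LinearOrder.lift' key key_injective

theorem lt_iff {x y : Position W} : x < y ↔ x.letter < y.letter ∨ (x.letter = y.letter ∧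
    (x.block < y.block ∨ (x.block = y.block ∧ x.idx.1 < y.idx.1))) := by
  change key x < key y ↔ _
  simp only [key, Prod.Lex.toLex_lt_toLex, Fin.val_inj, Fin.val_fin_lt]

theorem realizes_stdCycles_subset (W : Fin p → List A) (I : Finset (Fin p)) :
    Realizes next {x : Position W | x.block ∈ I} (stdCycles ((I.sort (· ≤ ·)).map W)) := by
  have h := realizes_stdCycles (letter : Position W → A) ((I.sort (· ≤ ·)).map (inBlock W)) ?_
    next ?_
  · have h1 : ((I.sort (· ≤ ·)).map (inBlock W)).map (List.map letter) =
        (I.sort (· ≤ ·)).map W := by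
      rw [List.map_map]
      exact List.map_congr_left fun b _ => map_letter_inBlock b
    have h2 : {x : Position W | x ∈ ((I.sort (· ≤ ·)).map (inBlock W)).flatten} =
        {x | x.block ∈ I} := by
      ext x
      simp [mem_inBlock]
    rwa [h1, h2] at h
  · have key : ∀ {x y : Position W},
        (x.block < y.block ∨ (x.block = y.block ∧ x.idx.1 < y.idx.1)) →
        (x < y ↔ x.letter ≤ y.letter) := fun h => by
      rw [lt_iff, le_iff_lt_or_eq, and_iff_left h]
    rw [List.pairwise_flatten]
    constructor
    · intro l hl
      obtain ⟨b, -, rfl⟩ := List.mem_map.1 hl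
      refine List.pairwise_map.2 ((List.pairwise_lt_finRange _).imp ?_)
      intro t s h
      exact key (Or.inr ⟨rfl, h⟩)
    · refine List.pairwise_map.2 ((Finset.sortedLT_sort I).pairwise.imp fun h x hx y hy => ?_)
      rw [mem_inBlock] at hx hy
      exact key (Or.inl (by rwa [hx, hy]))
  · intro l hl t ht
    obtain ⟨b, -, rfl⟩ := List.mem_map.1 hl
    have hlen : (inBlock W b).length = (W b).length := by simp [inBlock]
    have hget : ∀ t (ht : t < (inBlock W b).length),
        (inBlock W b)[t] = ⟨b, ⟨t, by rwa [hlen] at ht⟩⟩ := fun t ht => by simp [inBlock]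
    rw [hget, hget]
    simp only [next, hlen]

end Position

variable [LinearOrder (CircularWord A)]

/-- Every product of circular words is the product of a nondecreasing family. -/
theorem exists_monotone_eq_map (m : Multiset (CircularWord A)) :
    ∃ (p : ℕ) (w : Fin p → CircularWord A), Monotone w ∧ Finset.univ.val.map w = m := by
  refine ⟨_, (m.sort (· ≤ ·)).get, ?_, ?_⟩
  · exact (Multiset.pairwise_sort m (· ≤ ·)).sortedLE.monotone_get
  · conv_rhs => rw [← Multiset.sort_eq m (· ≤ ·)]
    rw [Fin.univ_val_map, List.ofFn_get]

variable [LinearOrder A] {rep : CircularWord A → List A}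

/-- A subproduct of a product of circular words corresponds to a union of cycles. -/
theorem realizes_cstd {p : ℕ} {w : Fin p → CircularWord A} (hw : Monotone w) (I : Finset (Fin p)) :
    Realizes Position.next {x : Position (rep ∘ w) | x.block ∈ I}
      (cstd rep (I.val.map w)) := by
  have h : (I.val.map w).sort (· ≤ ·) = (I.sort (· ≤ ·)).map w := by
    refine List.Perm.eq_of_pairwise' (Multiset.pairwise_sort _ _)
      (List.pairwise_map.2 ((Finset.pairwise_sort I _).imp fun h => hw h)) ?_
    rw [← Multiset.coe_eq_coe, Multiset.sort_eq, ← Multiset.map_coe, Finset.sort_eq]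
  rw [cstd, h, List.map_map]
  exact Position.realizes_stdCycles_subset (rep ∘ w) I

/-- The ways to split a product of circular words into factors with standardizations `σ` and `τ`
are counted by a number that depends only on the standardization of the product. -/
theorem card_subset_cstd_eq (hrep : ∀ c, rep c ≠ []) {p : ℕ} {w : Fin p → CircularWord A}
    (hw : Monotone w) (σ τ : Σ n : ℕ, Equiv.Perm (Fin n)) :
    Nat.card {I : Finset (Fin p) // cstd rep (I.val.map w) = σ ∧ cstd rep (Iᶜ.val.map w) = τ} =
      Nat.card (Split (cstd rep (Finset.univ.val.map w)).2 σ τ) := by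
  classical
  have huniv : Realizes (Position.next (W := rep ∘ w)) Set.univ (cstd rep (Finset.univ.val.map w)) := by
    simpa using realizes_cstd (rep := rep) hw Finset.univ
  rw [← huniv.card_split_eq]
  -- a splitting is invariant under `next`, hence determined by the set of words in its first part
  have hinv : ∀ (s : Split (Position.next (W := rep ∘ w)) σ τ) (x y : Position (rep ∘ w)),
      x.block = y.block → x ∈ Set.range s.1.1 → y ∈ Set.range s.1.1 := by
    intro s x y hxy hx
    obtain ⟨d, rfl⟩ := Position.exists_iterate_next hxy
    clear hxy
    induction d generalizing x with
    | zero => exact hx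
    | succ d ih =>
      obtain ⟨z, rfl⟩ := hx
      rw [Function.iterate_succ_apply]
      exact ih _ ⟨_, (s.2.2.1 z).symm⟩
  let start : Fin p → Position (rep ∘ w) := fun b =>
    ⟨b, ⟨0, List.length_pos_iff.2 (hrep (w b))⟩⟩
  let J : Split (Position.next (W := rep ∘ w)) σ τ → Finset (Fin p) := fun s =>
    Finset.univ.filter fun b => start b ∈ Set.range s.1.1
  have hJ : ∀ s x, x.block ∈ J s ↔ x ∈ Set.range s.1.1 := fun s x => by
    simp only [J, Finset.mem_filter, Finset.mem_univ, true_and]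
    exact ⟨hinv s _ _ rfl, hinv s _ _ rfl⟩
  have hJ1 : ∀ s, Set.range s.1.1 = {x | x.block ∈ J s} := fun s =>
    Set.ext fun x => (hJ s x).symm
  have hJ2 : ∀ s, Set.range s.1.2 = {x | x.block ∈ (J s)ᶜ} := fun s => by
    rw [← s.2.1.compl_eq, hJ1]
    ext x; simp
  symm
  refine Nat.card_eq_of_bijective (fun s => ⟨J s, ?_, ?_⟩) ⟨fun s s' h => ?_, fun I => ?_⟩
  · exact (realizes_cstd hw (J s)).unique ⟨s.1.1, hJ1 s, s.2.2.1⟩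
  · exact (realizes_cstd hw (J s)ᶜ).unique ⟨s.1.2, hJ2 s, s.2.2.2⟩
  · have h : J s = J s' := congrArg Subtype.val h
    refine Subtype.ext (Prod.ext (OrderEmbedding.eq_of_range_eq ?_)
      (OrderEmbedding.eq_of_range_eq ?_))
    · rw [hJ1, hJ1, h]
    · rw [hJ2, hJ2, h]
  · obtain ⟨I, rfl, rfl⟩ := I
    obtain ⟨i, hi, hi'⟩ := realizes_cstd (rep := rep) hw I
    obtain ⟨j, hj, hj'⟩ := realizes_cstd (rep := rep) hw Iᶜ
    refine ⟨⟨(i, j), ?_, hi', hj'⟩, Subtype.ext (Finset.ext fun b => ?_)⟩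
    · have : {x : Position (rep ∘ w) | x.block ∈ Iᶜ} = {x | x.block ∈ I}ᶜ := by ext; simp
      simp only [hi, hj, this]
      exact isCompl_compl
    · have := (hJ ⟨(i, j), by
        have : {x : Position (rep ∘ w) | x.block ∈ Iᶜ} = {x | x.block ∈ I}ᶜ := by ext; simp
        simp only [hi, hj, this]
        exact isCompl_compl, hi', hj'⟩ (start b))
      exact this.trans (by rw [hi]; rfl)

/-- Every permutation is a circular standardization: replace the entries of its cycles by
increasing letters. -/
theorem cstd_surjective [Infinite A] (hrep : ∀ c, (rep c : Cycle A) = c.1) :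
    Function.Surjective (cstd rep) := by
  classical
  rintro ⟨n, σ⟩
  obtain ⟨s, hs⟩ := Infinite.exists_subset_card_eq A n
  let a : Fin n ↪o A := s.orderEmbOfFin hs
  have hper : ∀ x, x ∈ Function.periodicPts σ := fun x => σ.injective.mem_periodicPts x
  let cyc : Fin n → CircularWord A := fun x => ⟨(Function.periodicOrbit σ x).map a, fun h =>
    Function.periodicOrbit_eq_nil_iff_not_periodic_pt.1 ((Cycle.map_eq_nil _ _).1 h) (hper x)⟩
  obtain ⟨p, w, hw, hm⟩ := exists_monotone_eq_map (Finset.univ.image cyc).val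
  have hwinj : Function.Injective w := fun b c h =>
    Multiset.inj_on_of_nodup_map (by rw [hm]; exact Finset.nodup _) b (Finset.mem_univ_val b) c
      (Finset.mem_univ_val c) h
  -- every chosen representative reads off an orbit of `σ` from some starting point `z b`
  have hz : ∀ b, ∃ z, w b = cyc z ∧ (rep (w b)).length = Function.minimalPeriod σ z ∧
      ∀ (t : ℕ) (ht : t < (rep (w b)).length), (rep (w b))[t] = a (σ^[t] z) := by
    intro b
    have hb : w b ∈ Finset.univ.image cyc := by
      rw [← Finset.mem_val, ← hm]; exact Multiset.mem_map_of_mem w (Finset.mem_univ_val b)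
    obtain ⟨x, -, hx⟩ := Finset.mem_image.1 hb
    have hr : (((List.range (Function.minimalPeriod σ x)).map fun k => σ^[k] x).map a) ~r
        rep (w b) := by
      rw [← Cycle.coe_eq_coe, hrep, ← hx]; rfl
    obtain ⟨k, hk⟩ := hr
    refine ⟨σ^[k] x, ?_, ?_, fun t ht => ?_⟩
    · rw [← hx]
      exact Subtype.ext (congrArg (Cycle.map a)
        (Function.periodicOrbit_apply_iterate_eq (hper x) k).symm)
    · rw [← hk, Function.minimalPeriod_apply_iterate (hper x)]
      simp
    · simp only [← hk, List.getElem_rotate, List.getElem_map, List.getElem_range, List.length_map,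
        List.length_range, Function.iterate_mod_minimalPeriod_eq]
      rw [Function.iterate_add_apply]
  choose z hz hlen hget using hz
  -- the letters are distinct, so sorting the positions by their letters recovers `Fin n`
  let g : Position (rep ∘ w) → Fin n := fun x => σ^[x.idx] (z x.block)
  have hletter : ∀ x, x.letter = a (g x) := fun x => hget x.block x.idx x.idx.2
  have hginj : Function.Injective g := by
    rintro ⟨b, t⟩ ⟨c, u⟩ h
    have hcyc : ∀ (x : Fin n) k, cyc (σ^[k] x) = cyc x := fun x k =>
      Subtype.ext (congrArg (Cycle.map a) (Function.periodicOrbit_apply_iterate_eq (hper x) k))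
    obtain rfl : b = c := hwinj <| by
      rw [hz b, hz c, ← hcyc (z b) t, ← hcyc (z c) u]
      exact congrArg cyc h
    have htu : t.1 = u.1 := (Function.iterate_eq_iterate_iff_of_lt_minimalPeriod
      (t.2.trans_eq (hlen b)) (u.2.trans_eq (hlen b))).1 h
    rw [Fin.ext htu]
  have hgsurj : Function.Surjective g := by
    intro y
    have hy : cyc y ∈ Finset.univ.val.map w := by
      rw [hm]; exact Finset.mem_image_of_mem cyc (Finset.mem_univ y)
    obtain ⟨b, -, hb⟩ := Multiset.mem_map.1 hy
    have hy : a y ∈ (cyc y).1 := Cycle.mem_map.2 ⟨y, Function.self_mem_periodicOrbit (hper y), rfl⟩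
    rw [← hb, hz b] at hy
    obtain ⟨y', hy', hyy⟩ := (Cycle.mem_map (f := a) (s := Function.periodicOrbit σ (z b))).1 hy
    obtain rfl := a.injective hyy
    obtain ⟨k, rfl⟩ := (Function.mem_periodicOrbit_iff (hper _)).1 hy'
    refine ⟨⟨b, ⟨k % Function.minimalPeriod σ (z b), ?_⟩⟩, ?_⟩
    · exact (Nat.mod_lt _ (Function.minimalPeriod_pos_of_mem_periodicPts (hper _))).trans_eq
        (hlen b).symm
    · exact Function.iterate_mod_minimalPeriod_eq
  have hgmono : StrictMono g := by
    intro x y h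
    rw [Position.lt_iff, hletter, hletter, a.lt_iff_lt, a.injective.eq_iff] at h
    rcases h with h | ⟨h, h'⟩
    · exact h
    · obtain rfl := hginj h
      simp at h'
  have hnext : ∀ x, g x.next = σ (g x) := by
    intro x
    have h : (rep (w x.block)).length = _ := hlen x.block
    simp only [g, Position.next, Function.comp_apply, h, Function.iterate_mod_minimalPeriod_eq]
    rw [Function.iterate_succ_apply']
  let e := StrictMono.orderIsoOfSurjective g hgmono hgsurj
  refine ⟨Finset.univ.val.map w, Realizes.unique (f := Position.next (W := rep ∘ w))
    (T := Set.univ) (by simpa using realizes_cstd (rep := rep) hw Finset.univ)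
    ⟨e.symm.toOrderEmbedding, e.symm.surjective.range_eq, fun y => ?_⟩⟩
  refine hginj ((hnext _).trans ?_)
  exact (congrArg σ (e.apply_symm_apply y)).trans (e.apply_symm_apply (σ y)).symm

end Positions

/-! ### The isomorphism -/

section SameConstants

variable {𝕂 X B₁ B₂ : Type*} [Field 𝕂] [Ring B₁] [Algebra 𝕂 B₁] [Ring B₂] [Algebra 𝕂 B₂]

/-- A family that contains the unit and whose products are combinations of the family spans a
subalgebra. -/
theorem adjoin_range_toSubmodule_eq_span {v : X → B₁} {x₀ : X} (h1 : v x₀ = 1)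
    {c : X → X → X →₀ 𝕂} (hv : ∀ x y, v x * v y = Finsupp.linearCombination 𝕂 v (c x y)) :
    (Algebra.adjoin 𝕂 (Set.range v)).toSubmodule = Submodule.span 𝕂 (Set.range v) := by
  refine le_antisymm ?_ (Algebra.span_le_adjoin 𝕂 _)
  have hmul : Submodule.span 𝕂 (Set.range v) * Submodule.span 𝕂 (Set.range v) ≤
      Submodule.span 𝕂 (Set.range v) := by
    rw [Submodule.span_mul_span, Submodule.span_le]
    rintro _ ⟨_, ⟨x, rfl⟩, _, ⟨y, rfl⟩, rfl⟩
    change v x * v y ∈ Submodule.span 𝕂 (Set.range v)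
    rw [hv]
    exact Finsupp.mem_span_range_iff_exists_finsupp.2 ⟨_, rfl⟩
  exact Algebra.adjoin_le (S := (Submodule.span 𝕂 (Set.range v)).toSubalgebra
    (h1 ▸ Submodule.subset_span ⟨x₀, rfl⟩)
    fun a b ha hb => hmul (Submodule.mul_mem_mul ha hb)) Submodule.subset_span

/-- Algebras spanned by linearly independent families with the same structure constants are
isomorphic: both are isomorphic to the algebra spanned by the pairs `(v x, w x)`. -/
theorem exists_adjoin_algEquiv {v : X → B₁} {w : X → B₂} (hv : LinearIndependent 𝕂 v)
    (hw : LinearIndependent 𝕂 w) {x₀ : X} (hv1 : v x₀ = 1) (hw1 : w x₀ = 1) {c : X → X → X →₀ 𝕂}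
    (hvc : ∀ x y, v x * v y = Finsupp.linearCombination 𝕂 v (c x y))
    (hwc : ∀ x y, w x * w y = Finsupp.linearCombination 𝕂 w (c x y)) :
    ∃ e : Algebra.adjoin 𝕂 (Set.range v) ≃ₐ[𝕂] Algebra.adjoin 𝕂 (Set.range w),
      ∀ x, (e ⟨v x, Algebra.subset_adjoin ⟨x, rfl⟩⟩ : B₂) = w x := by
  let u : X → B₁ × B₂ := fun x => (v x, w x)
  have hfst : ∀ t, (Finsupp.linearCombination 𝕂 u t).1 = Finsupp.linearCombination 𝕂 v t :=
    fun t => Finsupp.apply_linearCombination 𝕂 (LinearMap.fst 𝕂 B₁ B₂) u t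
  have hsnd : ∀ t, (Finsupp.linearCombination 𝕂 u t).2 = Finsupp.linearCombination 𝕂 w t :=
    fun t => Finsupp.apply_linearCombination 𝕂 (LinearMap.snd 𝕂 B₁ B₂) u t
  let G := Algebra.adjoin 𝕂 (Set.range u)
  have hG : ∀ g : G, ∃ t, Finsupp.linearCombination 𝕂 u t = g := by
    intro g
    have h := adjoin_range_toSubmodule_eq_span (v := u) (x₀ := x₀) (Prod.ext hv1 hw1) (c := c)
      fun x y => Prod.ext ((hvc x y).trans (hfst _).symm) ((hwc x y).trans (hsnd _).symm)
    have hg : (g : B₁ × B₂) ∈ Submodule.span 𝕂 (Set.range u) := h ▸ g.2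
    exact (Finsupp.mem_span_range_iff_exists_finsupp.1 hg)
  let f₁ : G →ₐ[𝕂] B₁ := (AlgHom.fst 𝕂 B₁ B₂).comp G.val
  let f₂ : G →ₐ[𝕂] B₂ := (AlgHom.snd 𝕂 B₁ B₂).comp G.val
  have hf₁ : Function.Injective f₁ := by
    rw [injective_iff_map_eq_zero]
    intro g hg
    obtain ⟨t, ht⟩ := hG g
    have h0 : Finsupp.linearCombination 𝕂 v t = 0 := by rw [← hfst, ht]; exact hg
    rw [linearIndependent_iff.1 hv t h0, map_zero] at ht
    exact Subtype.ext ht.symm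
  have hf₂ : Function.Injective f₂ := by
    rw [injective_iff_map_eq_zero]
    intro g hg
    obtain ⟨t, ht⟩ := hG g
    have h0 : Finsupp.linearCombination 𝕂 w t = 0 := by rw [← hsnd, ht]; exact hg
    rw [linearIndependent_iff.1 hw t h0, map_zero] at ht
    exact Subtype.ext ht.symm
  have hr₁ : f₁.range = Algebra.adjoin 𝕂 (Set.range v) := by
    rw [AlgHom.range_comp, Subalgebra.range_val, AlgHom.map_adjoin, ← Set.range_comp]; rfl
  have hr₂ : f₂.range = Algebra.adjoin 𝕂 (Set.range w) := by
    rw [AlgHom.range_comp, Subalgebra.range_val, AlgHom.map_adjoin, ← Set.range_comp]; rfl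
  let e₁ := (AlgEquiv.ofInjective f₁ hf₁).trans (Subalgebra.equivOfEq _ _ hr₁)
  let e₂ := (AlgEquiv.ofInjective f₂ hf₂).trans (Subalgebra.equivOfEq _ _ hr₂)
  refine ⟨e₁.symm.trans e₂, fun x => ?_⟩
  have h : e₁.symm ⟨v x, Algebra.subset_adjoin ⟨x, rfl⟩⟩ =
      ⟨u x, Algebra.subset_adjoin ⟨x, rfl⟩⟩ := by
    rw [AlgEquiv.symm_apply_eq]; rfl
  rw [AlgEquiv.trans_apply, h]
  rfl

end SameConstants

section Main

variable {𝕂 : Type*} [Field 𝕂]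

/-- The structure constants common to the projectors `π_σ` and to the `M_σ`: the coefficient of the
basis element of index `ρ` in the product of those of indices `σ` and `τ` is the number of ways to
split `ρ` into `σ` and `τ`. -/
noncomputable def splitConst (𝕂 : Type*) [Field 𝕂] (σ τ : Σ n : ℕ, Equiv.Perm (Fin n)) :
    (Σ n : ℕ, Equiv.Perm (Fin n)) →₀ 𝕂 :=
  ∑ ρ : Equiv.Perm (Fin (σ.1 + τ.1)),
    Finsupp.single ⟨σ.1 + τ.1, ρ⟩ (Nat.card (Split ρ σ τ) : 𝕂)

theorem linearCombination_splitConst {B : Type*} [AddCommGroup B] [Module 𝕂 B]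
    (v : (Σ n : ℕ, Equiv.Perm (Fin n)) → B) (σ τ : Σ n : ℕ, Equiv.Perm (Fin n)) :
    Finsupp.linearCombination 𝕂 v (splitConst 𝕂 σ τ) =
      ∑ ρ : Equiv.Perm (Fin (σ.1 + τ.1)),
        (Nat.card (Split ρ σ τ) : 𝕂) • v ⟨σ.1 + τ.1, ρ⟩ := by
  simp [splitConst, map_sum, Finsupp.linearCombination_single]

variable {A : Type*} [LinearOrder A] [LinearOrder (CircularWord A)] {rep : CircularWord A → List A}

theorem circularProj_mul [CharZero 𝕂] (hrep : ∀ c, rep c ≠ [])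
    (hdec : DirectSum.IsInternal (HComponent 𝕂 rep)) (σ τ : Σ n : ℕ, Equiv.Perm (Fin n)) :
    circularProj hdec σ * circularProj hdec τ = ∑ ρ : Equiv.Perm (Fin (σ.1 + τ.1)),
      (Nat.card (Split ρ σ τ) : 𝕂) • circularProj hdec ⟨σ.1 + τ.1, ρ⟩ := by
  refine conv_ext 𝕂 fun m => ?_
  obtain ⟨p, w, hw, rfl⟩ := exists_monotone_eq_map m
  rw [circularProj_mul_circularMonomial, card_subset_cstd_eq hrep hw]
  simp only [WithConv.ofConv_sum, WithConv.ofConv_smul, LinearMap.sum_apply, LinearMap.smul_apply,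
    circularProj_circularMonomial]
  generalize circularMonomial 𝕂 (Finset.univ.val.map w) = x
  generalize cstd rep (Finset.univ.val.map w) = ρ
  obtain ⟨n, ρ⟩ := ρ
  by_cases hn : n = σ.1 + τ.1
  · subst hn
    rw [Finset.sum_eq_single ρ]
    · simp
    · intro ρ' _ h
      rw [if_neg, smul_zero]
      simpa using h.symm
    · simp
  · have : IsEmpty (Split ρ σ τ) := ⟨fun s => hn s.card_eq⟩
    rw [Nat.card_of_isEmpty, Nat.cast_zero, zero_smul]
    refine (Finset.sum_eq_zero fun ρ' _ => ?_).symm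
    rw [if_neg (fun h => hn (congrArg Sigma.fst h)), smul_zero]

theorem circularProj_one [CharZero 𝕂] (hrep : ∀ c, rep c ≠ [])
    (hdec : DirectSum.IsInternal (HComponent 𝕂 rep)) : circularProj hdec ⟨0, 1⟩ = 1 := by
  classical
  refine conv_ext 𝕂 fun m => ?_
  have hm : cstd rep m = ⟨0, 1⟩ ↔ m = 0 := by
    constructor
    · intro h
      have h : ((m.sort (· ≤ ·)).map rep).flatten.length = 0 := congrArg Sigma.fst h
      rw [List.length_eq_zero_iff, List.flatten_eq_nil_iff] at h
      refine Multiset.eq_zero_of_forall_notMem fun c hc => hrep c (h _ ?_)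
      exact List.mem_map_of_mem ((Multiset.mem_sort _).2 hc)
    · rintro rfl
      have h : (cstd rep 0).1 = 0 := by simp [cstd, stdCycles]
      generalize cstd rep 0 = σ at h
      obtain ⟨n, σ⟩ := σ
      obtain rfl : n = 0 := h
      rw [Subsingleton.elim σ 1]
  rw [circularProj_circularMonomial, LinearMap.convOne_apply, counit_circularMonomial]
  simp only [hm]
  split_ifs with h
  · subst h; simp [circularMonomial]
  · simp

end Main

theorem mainTheorem7 {𝕂 : Type*} [Field 𝕂] [CharZero 𝕂]
    {A : Type*} [LinearOrder A] [Infinite A] [LinearOrder (CircularWord A)]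
    (rep : CircularWord A → List A) (hrep : ∀ c, (rep c : Cycle A) = c.1) :
    (SGQSym 𝕂).toSubmodule = Submodule.span 𝕂 (Set.range (MPerm 𝕂)) ∧
    ∃ hdec : DirectSum.IsInternal (HComponent 𝕂 rep),
      ∃ S : Subalgebra 𝕂 (WithConv (HAlg 𝕂 (A →₀ 𝕂) →ₗ[𝕂] HAlg 𝕂 (A →₀ 𝕂))),
        S ≤ gradedEnd 𝕂 (A →₀ 𝕂) ∧
        S.toSubmodule = Submodule.span 𝕂 (Set.range (circularProj hdec)) ∧
        ∃ e : S ≃ₐ[𝕂] SGQSym 𝕂, ∀ σ : Σ n : ℕ, Equiv.Perm (Fin n),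
          ∃ hσ : circularProj hdec σ ∈ S, (e ⟨circularProj hdec σ, hσ⟩ : _ ⧸ _) = MPerm 𝕂 σ := by
  have hne : ∀ c, rep c ≠ [] := fun c h => c.2 (by rw [← hrep, h]; rfl)
  have hdec := isInternal_HComponent 𝕂 rep
  have hM : ∀ σ τ, MPerm 𝕂 σ * MPerm 𝕂 τ =
      Finsupp.linearCombination 𝕂 (MPerm 𝕂) (splitConst 𝕂 σ τ) := fun σ τ => by
    rw [MPerm_mul, linearCombination_splitConst]
  have hπ : ∀ σ τ, circularProj hdec σ * circularProj hdec τ =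
      Finsupp.linearCombination 𝕂 (circularProj hdec) (splitConst 𝕂 σ τ) := fun σ τ => by
    rw [circularProj_mul hne, linearCombination_splitConst]
  have h1 := adjoin_range_toSubmodule_eq_span (MPerm_one 𝕂) hM
  have h2 := adjoin_range_toSubmodule_eq_span (circularProj_one hne hdec) hπ
  have h3 : Algebra.adjoin 𝕂 (Set.range (circularProj hdec)) ≤ gradedEnd 𝕂 (A →₀ 𝕂) :=
    Algebra.adjoin_le (Set.range_subset_iff.2 (circularProj_mem_gradedEnd hdec))
  have h4 := exists_adjoin_algEquiv
    (linearIndependent_circularProj hdec (cstd_surjective hrep)) (linearIndependent_MPerm 𝕂)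
    (circularProj_one hne hdec) (MPerm_one 𝕂) hπ hM
  obtain ⟨e, he⟩ := h4
  refine ⟨h1, hdec, Algebra.adjoin 𝕂 (Set.range (circularProj hdec)), h3, h2, ?_⟩
  exact ⟨e, fun σ => ⟨Algebra.subset_adjoin ⟨σ, rfl⟩, he σ⟩⟩
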